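/- Setting. Let $\mathbb T\subset\mathbb C$ be the unit circle. For a function $f$ of a complex variable put $f^*(z)=\overline{f(1/\bar z)}$, and for a complex measure $\mu$ on $\mathbb T$ and polynomials $f,g$ put $\langle f,g\rangle_\mu=\int_{\mathbb T} f g^*\,d\mu$. A polynomial $\Phi$ is called left (right) orthogonal if $\langle \Phi,p\rangle_\mu=0$ (respectively $\langle p,\Phi\rangle_\mu=0$) for all polynomials $p$ of degree strictly less than that of $\Phi$. Let $\mathcal T$ be the class of complex measures $\mu$ on $\mathbb T$ with $\mu(\mathbb T)=1$ such that for every $n\ge 0$ there are a unique monic left orthogonal polynomial $\Phi_n$ and a unique monic right orthogonal polynomial $\tilde\Phi_n$ of degree $n$. For $\mu\in\mathcal T$ there are unique complex numbers $F_n,\tilde F_n$ ($n\ge 1$) with $$\Phi_{n+1}-z\Phi_n=\overline{F_{n+1}}\,z^n\tilde\Phi_n^*,\qquad \tilde\Phi_{n+1}-z\tilde\Phi_n=\overline{\tilde F_{n+1}}\,z^n\Phi_n^*\qquad(n\ge 0).$$ Let $\mathcal T_-$ be the class of $\mu\in\mathcal T$ with $F_n=-\tilde F_n$ for all $n\ge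 1$. For $\mu\in\mathcal T_-$ one has $\langle\Phi_n,\tilde\Phi_n\rangle_\mu>0$, and $\phi_n:=\Phi_n/\sqrt{\langle\Phi_n,\tilde\Phi_n\rangle_\mu}$. Let $\frac{w}{2\pi}$ be (any fixed version of) the Radon-Nikodym derivative of $\mu$ with respect to arclength, and let $E(\mu)$ be the set of $s\in\mathbb T$ outside the support of the singular part of $\mu$ that are Lebesgue points of $\frac{w}{2\pi}$. For $n\ge 1$ and $s\in\mathbb T$ let $\gamma_n=e^{i\pi/n}$ and $$A_{n,s}=\frac{\phi_n(s)-\phi_n(s\gamma_n)}{2s^n},\qquad B_{n,s}=\frac{\phi_n(s)+\phi_n(s\gamma_n)}{2}.$$ Theorem. Let $\mu\in\mathcal T_-$, $s\in E(\mu)$ and $0<\epsilon<10^{-5}$. Then there is an $n_0>40$ such that for all $n>n_0$ the following hold. (1) If $|A_{n,s}B_{n,s}|\ge\epsilon$, then $\min\{|z-s|:\phi_n(z)=0\}\le 10^4\epsilon^{-1}n^{-1}$. (2) If $|w(s)|<e^{\epsilon^{-1}}$ and $\min\{|z-s|:\phi_n(z)=0\}\le\epsilon^{-1}n^{-1}$,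 then $|A_{n,s}B_{n,s}|\ge e^{-10\epsilon^{-1}}$. -/

import Mathlib

open MeasureTheory Polynomial Filter Topology
open scoped ComplexConjugate

noncomputable section

namespace OneSidedOP

/-- The Borel σ-algebra on the unit circle. -/
instance circleMeasurableSpace : MeasurableSpace Circle := borel Circle

instance circleBorelSpace : BorelSpace Circle := ⟨rfl⟩

/-- Arclength measure on the unit circle (of total mass `2π`). -/
def arcLength : Measure Circle :=
  (volume.restrict (Set.Ioc (-Real.pi) Real.pi)).map Circle.exp

/-- `f^*(z) = conj (f (1 / conj z))`; on the unit circle this is the complex conjugate of `f`. -/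
def starFn (f : ℂ → ℂ) (z : ℂ) : ℂ := conj (f (conj z)⁻¹)

/-- The pairing `⟨f, g⟩_μ = ∫ f g^* dμ` of two polynomials, for a complex measure `μ` on the
circle. -/
def pairing (μ : ComplexMeasure Circle) (f g : ℂ[X]) : ℂ :=
  μ.integral (fun z : Circle => f.eval (z : ℂ) * starFn (fun x => g.eval x) (z : ℂ))
    (ContinuousLinearMap.mul ℝ ℂ)

/-- `P` is a left orthogonal monic polynomial of degree `n`. -/
structure IsLeftMonicOP (μ : ComplexMeasure Circle) (n : ℕ) (P : ℂ[X]) : Prop where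
  monic : P.Monic
  natDegree_eq : P.natDegree = n
  orthogonal : ∀ p : ℂ[X], p.degree < P.degree → pairing μ P p = 0

/-- `P` is a right orthogonal monic polynomial of degree `n`. -/
structure IsRightMonicOP (μ : ComplexMeasure Circle) (n : ℕ) (P : ℂ[X]) : Prop where
  monic : P.Monic
  natDegree_eq : P.natDegree = n
  orthogonal : ∀ p : ℂ[X], p.degree < P.degree → pairing μ p P = 0

/-- The class `𝒯` of complex measures `μ` on the circle with `μ(𝕋) = 1` which have, in each degree,
a unique left and a unique right orthogonal monic polynomial. -/
structure ClassT (μ : ComplexMeasure Circle) : Prop where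
  mass_one : μ Set.univ = 1
  left : ∀ n : ℕ, ∃! P : ℂ[X], IsLeftMonicOP μ n P
  right : ∀ n : ℕ, ∃! P : ℂ[X], IsRightMonicOP μ n P

open Classical in
/-- The monic left orthogonal polynomial `Φ_n` (used only for `μ` in the class `𝒯`). -/
def leftMonic (μ : ComplexMeasure Circle) (n : ℕ) : ℂ[X] :=
  if h : ∃ P : ℂ[X], IsLeftMonicOP μ n P then h.choose else 0

open Classical in
/-- The monic right orthogonal polynomial `Φ̃_n` (used only for `μ` in the class `𝒯`). -/
def rightMonic (μ : ComplexMeasure Circle) (n : ℕ) : ℂ[X] :=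
  if h : ∃ P : ℂ[X], IsRightMonicOP μ n P then h.choose else 0

/-- The Szegő relation `P' - z P = conj c * z^n * Q^*`, as an identity on `ℂ \ {0}`. -/
def SzegoRel (P' P Q : ℂ[X]) (n : ℕ) (c : ℂ) : Prop :=
  ∀ z : ℂ, z ≠ 0 →
    P'.eval z - z * P.eval z = conj c * z ^ n * starFn (fun x => Q.eval x) z

open Classical in
/-- The coefficients `F_n`, `n ≥ 1`, of the left Szegő recurrence
`Φ_{n+1} - z Φ_n = conj F_{n+1} * z^n * Φ̃_n^*`; for `μ` in the class `𝒯` there is exactly one such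
number. The value at `n = 0` is not used. -/
def leftCoeff (μ : ComplexMeasure Circle) : ℕ → ℂ
  | 0 => 0
  | n + 1 =>
    if h : ∃ c : ℂ, SzegoRel (leftMonic μ (n + 1)) (leftMonic μ n) (rightMonic μ n) n c
    then h.choose else 0

open Classical in
/-- The coefficients `F̃_n`, `n ≥ 1`, of the right Szegő recurrence
`Φ̃_{n+1} - z Φ̃_n = conj F̃_{n+1} * z^n * Φ_n^*`; for `μ` in the class `𝒯` there is exactly one such
number. The value at `n = 0` is not used. -/
def rightCoeff (μ : ComplexMeasure Circle) : ℕ → ℂ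
  | 0 => 0
  | n + 1 =>
    if h : ∃ c : ℂ, SzegoRel (rightMonic μ (n + 1)) (rightMonic μ n) (leftMonic μ n) n c
    then h.choose else 0

/-- The class `𝒯₋` of the measures in `𝒯` with `F_n = -F̃_n` for all `n ≥ 1`. -/
structure ClassTMinus (μ : ComplexMeasure Circle) : Prop extends ClassT μ where
  coeff_eq_neg : ∀ n : ℕ, 1 ≤ n → leftCoeff μ n = -rightCoeff μ n

/-- The normalized left orthogonal polynomial `φ_n = Φ_n / √⟨Φ_n, Φ̃_n⟩_μ`. For `μ` in the class
`𝒯₋` the number `⟨Φ_n, Φ̃_n⟩_μ` is real and positive, so that it is its own real part. -/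
def phi (μ : ComplexMeasure Circle) (n : ℕ) : ℂ[X] :=
  C (((Real.sqrt (pairing μ (leftMonic μ n) (rightMonic μ n)).re : ℝ) : ℂ)⁻¹) * leftMonic μ n

/-- `w / (2π)` is a version of the Radon-Nikodym derivative of `μ` with respect to arclength. -/
def IsDensity (μ : ComplexMeasure Circle) (w : Circle → ℂ) : Prop :=
  (fun y => w y / ((2 * Real.pi : ℝ) : ℂ)) =ᵐ[arcLength] μ.rnDeriv arcLength

/-- The set `E(μ)`, for a given version `w / (2π)` of the density of `μ`: the points `s` outside the
support of the singular part of `μ` which are Lebesgue points of `w / (2π)` with respect to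
arclength (closed balls of the circle are the closed arcs centred at `s`). -/
def regularSet (μ : ComplexMeasure Circle) (w : Circle → ℂ) : Set Circle :=
  {s | s ∉ (μ.singularPart arcLength).variation.support ∧
    Tendsto (fun r : ℝ => ⨍ y in Metric.closedBall s r,
        ‖w y / ((2 * Real.pi : ℝ) : ℂ) - w s / ((2 * Real.pi : ℝ) : ℂ)‖ ∂arcLength)
      (𝓝[>] 0) (𝓝 0)}

/-- `γ_n = e^{iπ/n}`. -/
def gam (n : ℕ) : ℂ := Complex.exp (Complex.I * Real.pi / n)

/-- The local parameter `A_{n,s} = (φ_n(s) - φ_n(s γ_n)) / (2 s^n)`. -/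
def paramA (μ : ComplexMeasure Circle) (n : ℕ) (s : Circle) : ℂ :=
  ((phi μ n).eval (s : ℂ) - (phi μ n).eval ((s : ℂ) * gam n)) / (2 * (s : ℂ) ^ n)

/-- The local parameter `B_{n,s} = (φ_n(s) + φ_n(s γ_n)) / 2`. -/
def paramB (μ : ComplexMeasure Circle) (n : ℕ) (s : Circle) : ℂ :=
  ((phi μ n).eval (s : ℂ) + (phi μ n).eval ((s : ℂ) * gam n)) / 2

end OneSidedOP

end

/-!
Write `Φ_n`, `Φ̃_n` for the left and right monic orthogonal polynomials, `u_n = Φ_n`,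
`v_n = z ^ n Φ̃_n^*` and `c_n = conj F_{n+1}`. As `F̃ = -F`, the Szegő recurrences read
`u_{n+1} = z u_n + c_n v_n` and `v_{n+1} = v_n - conj c_n z u_n`: up to the factor
`√(1 + |c_n|²)`, each step is a unitary matrix times `diag (z, 1)`. Hence
`⟨Φ_n, Φ̃_n⟩ = ∏_{k<n} (1 + |c_k|²) =: h_n`, and `|u_n|² + |v_n|² ≤ 2 h_n max (1, |z|) ^ (2 n)`
(`SzegoSystem.normSq_add_normSq_le`): the normalized vectors are bounded on the circle and on its
neighbourhood of size `O (1 / n)`.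

The kernel `K_n(l, x) = ∑_{k<n} Φ_k(l) Φ̃_k^*(x) / h_k` reproduces polynomials of degree less than
`n` (`SzegoSystem.reproducing`), and the Christoffel–Darboux formula
(`SzegoSystem.christoffel_darboux`) expresses it by the cross product
`D_n(l, x) = (u_n(l) v_n(x) - v_n(l) u_n(x)) / h_n`. Therefore `K_n` is `O (n)` and
`O (1 / |l - x|)` on the circle.

Let `s` be a regular point and let `l`, `t` lie within `O (1 / n)` of `s`. Testing the reproducing
property against the Dirichlet kernel `q(x) = ∑_{k<n} (x conj t) ^ k` gives
`∫ q(x) K_n(l, x) dμ(x) = q(l)`, whereas with respect to normalized arclength this integral is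
`K_n(l, t)`. The integrand is `O (n²)` and `O (1 / |x - s|²)`, so the Lebesgue point condition allows
`μ` to be replaced by `w(s)` times normalized arclength with an error `o (n)`
(`integral_approx`). The result is
`w(s) D_n(l, t) = l ^ n - t ^ n + o (1)`, uniformly (`measDet_asymp`).

The linear dependence `φ_n(l) D_n(s, t) = φ_n(s) D_n(l, t) - φ_n(t) D_n(l, s)` with `t = s γ_n`,
`t ^ n = - s ^ n`, turns this into `φ_n(l) = A l ^ n + B + o (1)`; moreover
`|w(s) D_n(s, t)| ≥ 1` shows that `A` and `B` are not both small unless `w(s)` is large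
(`phi_asymp`). For the first claim, `A z ^ n + B` has an explicit zero near `s`, which persists under
small perturbations by the minimum principle (`exists_zero_of_close`). For the second, a zero of
`φ_n` near `s` makes `|A|` and `|B|` comparable, and their sum is bounded below
(`coeff_mul_ge_of_zero`).
-/

open MeasureTheory Polynomial Filter Topology
open scoped ComplexConjugate

noncomputable section

namespace OneSidedOP

/-! ### Toeplitz forms and the Szegő recurrence -/

/-- A sesquilinear form on polynomials, linear in the first argument, which is invariant under
simultaneous multiplication of both arguments by the variable. -/
structure IsToeplitz (B : ℂ[X] → ℂ[X] → ℂ) : Prop where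
  add_left : ∀ f₁ f₂ g, B (f₁ + f₂) g = B f₁ g + B f₂ g
  smul_left : ∀ (c : ℂ) (f g : ℂ[X]), B (C c * f) g = c * B f g
  add_right : ∀ f g₁ g₂, B f (g₁ + g₂) = B f g₁ + B f g₂
  smul_right : ∀ (c : ℂ) (f g : ℂ[X]), B f (C c * g) = conj c * B f g
  shift : ∀ f g, B (X * f) (X * g) = B f g

/-- The form with exchanged arguments; right orthogonality for `B` is left orthogonality for
`conjFlip B`. -/
def conjFlip (B : ℂ[X] → ℂ[X] → ℂ) (f g : ℂ[X]) : ℂ := conj (B g f)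

/-- `P` is monic of degree `n` and left orthogonal with respect to `B`. -/
structure IsMonicOP (B : ℂ[X] → ℂ[X] → ℂ) (n : ℕ) (P : ℂ[X]) : Prop where
  monic : P.Monic
  natDegree_eq : P.natDegree = n
  orthogonal : ∀ p : ℂ[X], p.degree < P.degree → B P p = 0

/-- The polynomial `z ^ n * f^*(z)`, for `f` of degree at most `n`. -/
def rev (n : ℕ) (f : ℂ[X]) : ℂ[X] := (f.map (starRingEnd ℂ)).reflect n

section rev

lemma coeff_rev {n i : ℕ} (f : ℂ[X]) (hi : i ≤ n) : (rev n f).coeff i = conj (f.coeff (n - i)) := by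
  simp [rev, coeff_reflect, revAt_le hi]

lemma coeff_rev_of_lt {n i : ℕ} {f : ℂ[X]} (hf : f.natDegree ≤ n) (hi : n < i) :
    (rev n f).coeff i = 0 := by
  simp [rev, coeff_reflect, revAt_eq_self_of_lt hi, coeff_eq_zero_of_natDegree_lt (hf.trans_lt hi)]

lemma natDegree_rev_le {n : ℕ} {f : ℂ[X]} (hf : f.natDegree ≤ n) : (rev n f).natDegree ≤ n :=
  natDegree_le_iff_coeff_eq_zero.2 fun _ hi => coeff_rev_of_lt hf hi

lemma rev_rev (n : ℕ) (f : ℂ[X]) : rev n (rev n f) = f := by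
  ext i
  simp [rev, coeff_reflect]

lemma rev_add (n : ℕ) (f g : ℂ[X]) : rev n (f + g) = rev n f + rev n g := by
  simp [rev, reflect_add]

lemma rev_C_mul (n : ℕ) (c : ℂ) (f : ℂ[X]) : rev n (C c * f) = C (conj c) * rev n f := by
  simp [rev, reflect_C_mul]

lemma rev_sum {ι : Type*} (n : ℕ) (s : Finset ι) (f : ι → ℂ[X]) :
    rev n (∑ i ∈ s, f i) = ∑ i ∈ s, rev n (f i) :=
  map_sum (AddMonoidHom.mk' (rev n) (rev_add n)) f s

lemma rev_X_pow {n i : ℕ} (hi : i ≤ n) : rev n (X ^ i) = X ^ (n - i) := by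
  simp [rev, reflect_monomial, revAt_le hi]

lemma rev_succ_X_mul (n : ℕ) {f : ℂ[X]} (hf : f.natDegree ≤ n) :
    rev (n + 1) (X * f) = rev n f := by
  ext i
  rcases lt_trichotomy i (n + 1) with hi | rfl | hi
  · rw [coeff_rev _ hi.le, coeff_rev _ (Nat.lt_succ_iff.1 hi), Nat.succ_sub (Nat.lt_succ_iff.1 hi),
      coeff_X_mul]
  · rw [coeff_rev _ le_rfl, coeff_rev_of_lt hf (Nat.lt_succ_self n)]
    simp
  · rw [coeff_rev_of_lt hf (by omega), coeff_rev_of_lt _ hi]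
    exact natDegree_mul_le.trans (by rw [natDegree_X]; omega)

lemma rev_succ_rev (n : ℕ) {f : ℂ[X]} (hf : f.natDegree ≤ n) :
    rev (n + 1) (rev n f) = X * f := by
  rw [← rev_succ_X_mul n hf, rev_rev]

lemma sum_C_mul_X_pow {N : ℕ} {f : ℂ[X]} (hf : f.natDegree < N) :
    f = ∑ i ∈ Finset.range N, C (f.coeff i) * X ^ i :=
  f.as_sum_range_C_mul_X_pow' hf

lemma rev_eq_sum {n : ℕ} {f : ℂ[X]} (hf : f.natDegree ≤ n) :
    rev n f = ∑ i ∈ Finset.range (n + 1), C (conj (f.coeff i)) * X ^ (n - i) := by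
  conv_lhs => rw [sum_C_mul_X_pow (Nat.lt_succ_iff.2 hf)]
  rw [rev_sum]
  refine Finset.sum_congr rfl fun i hi => ?_
  rw [rev_C_mul, rev_X_pow (Nat.lt_succ_iff.1 (Finset.mem_range.1 hi))]

lemma eval_rev {n : ℕ} {f : ℂ[X]} (hf : f.natDegree ≤ n) {z : ℂ} (hz : z ≠ 0) :
    (rev n f).eval z = z ^ n * starFn (fun x => f.eval x) z := by
  rw [rev_eq_sum hf, starFn]
  conv_rhs => rw [sum_C_mul_X_pow (Nat.lt_succ_iff.2 hf)]
  simp only [eval_finsetSum, eval_mul, eval_C, eval_pow, eval_X, map_sum, map_mul, map_pow, map_inv₀,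
    Complex.conj_conj, Finset.mul_sum]
  refine Finset.sum_congr rfl fun i hi => ?_
  have hi := Nat.lt_succ_iff.1 (Finset.mem_range.1 hi)
  rw [pow_sub₀ z hz hi, inv_pow]
  ring

end rev

namespace IsToeplitz

variable {B : ℂ[X] → ℂ[X] → ℂ}

lemma conjFlip (hB : IsToeplitz B) : IsToeplitz (conjFlip B) where
  add_left f₁ f₂ g := by simp [OneSidedOP.conjFlip, hB.add_right]
  smul_left c f g := by simp [OneSidedOP.conjFlip, hB.smul_right]
  add_right f g₁ g₂ := by simp [OneSidedOP.conjFlip, hB.add_left]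
  smul_right c f g := by simp [OneSidedOP.conjFlip, hB.smul_left]
  shift f g := by simp [OneSidedOP.conjFlip, hB.shift]

lemma sum_left (hB : IsToeplitz B) {ι : Type*} (s : Finset ι) (f : ι → ℂ[X]) (g : ℂ[X]) :
    B (∑ i ∈ s, f i) g = ∑ i ∈ s, B (f i) g :=
  map_sum (AddMonoidHom.mk' (fun f => B f g) fun a b => hB.add_left a b g) f s

lemma sum_right (hB : IsToeplitz B) {ι : Type*} (s : Finset ι) (f : ℂ[X]) (g : ι → ℂ[X]) :
    B f (∑ i ∈ s, g i) = ∑ i ∈ s, B f (g i) :=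
  map_sum (AddMonoidHom.mk' (fun g => B f g) fun a b => hB.add_right f a b) g s

lemma sub_left (hB : IsToeplitz B) (f₁ f₂ g : ℂ[X]) : B (f₁ - f₂) g = B f₁ g - B f₂ g :=
  map_sub (AddMonoidHom.mk' (fun f => B f g) fun a b => hB.add_left a b g) f₁ f₂

lemma sub_right (hB : IsToeplitz B) (f g₁ g₂ : ℂ[X]) : B f (g₁ - g₂) = B f g₁ - B f g₂ :=
  map_sub (AddMonoidHom.mk' (fun g => B f g) fun a b => hB.add_right f a b) g₁ g₂

lemma shift_pow (hB : IsToeplitz B) (k : ℕ) (f g : ℂ[X]) : B (X ^ k * f) (X ^ k * g) = B f g := by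
  induction k with
  | zero => simp
  | succ k ih => rw [pow_succ', mul_assoc, mul_assoc, hB.shift, ih]

lemma monomial_rev (hB : IsToeplitz B) {n i j : ℕ} (hi : i ≤ n) (hj : j ≤ n) :
    B (X ^ (n - i)) (X ^ (n - j)) = B (X ^ j) (X ^ i) := by
  rw [← hB.shift_pow (i + j), ← pow_add, ← pow_add, ← hB.shift_pow n (X ^ j), ← pow_add, ← pow_add]
  congr 2 <;> omega

/-- Reversal exchanges the arguments of a Toeplitz form: on the circle `f ↦ z ^ n * f^*` is
conjugation up to a unimodular factor which cancels in the pairing. -/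
lemma rev_rev (hB : IsToeplitz B) {n : ℕ} {f g : ℂ[X]} (hf : f.natDegree ≤ n)
    (hg : g.natDegree ≤ n) : B (rev n f) (rev n g) = B g f := by
  rw [rev_eq_sum hf, rev_eq_sum hg]
  conv_rhs => rw [sum_C_mul_X_pow (Nat.lt_succ_iff.2 hf), sum_C_mul_X_pow (Nat.lt_succ_iff.2 hg)]
  simp only [hB.sum_left, hB.sum_right, hB.smul_left, hB.smul_right, Complex.conj_conj]
  rw [Finset.sum_comm]
  refine Finset.sum_congr rfl fun j hj => Finset.sum_congr rfl fun i hi => ?_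
  rw [hB.monomial_rev (Nat.lt_succ_iff.1 (Finset.mem_range.1 hi))
    (Nat.lt_succ_iff.1 (Finset.mem_range.1 hj))]
  ring

/-- The reversed right orthogonal polynomial of degree `n` is orthogonal to `z, ..., z ^ n`. -/
lemma rev_orthogonal (hB : IsToeplitz B) {n : ℕ} {Q : ℂ[X]}
    (hQ : IsMonicOP (OneSidedOP.conjFlip B) n Q) {p : ℂ[X]} (hp : p.degree < n) : B (rev n Q) (X * p) = 0 := by
  have hpn : (X * p).natDegree ≤ n := by
    rw [natDegree_le_iff_coeff_eq_zero]
    intro N hN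
    obtain ⟨N, rfl⟩ := Nat.exists_eq_succ_of_ne_zero (by omega : N ≠ 0)
    rw [Nat.succ_eq_add_one, coeff_X_mul]
    exact (degree_lt_iff_coeff_zero _ _).1 hp _ (by omega)
  rw [← OneSidedOP.rev_rev n (X * p), hB.rev_rev hQ.natDegree_eq.le (natDegree_rev_le hpn)]
  have h := hQ.orthogonal (rev n (X * p)) ?_
  · simpa [OneSidedOP.conjFlip] using h
  · rw [degree_eq_natDegree hQ.monic.ne_zero, hQ.natDegree_eq, degree_lt_iff_coeff_zero]
    intro m hm
    rcases hm.eq_or_lt with rfl | hm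
    · simp [coeff_rev]
    · exact coeff_rev_of_lt hpn hm

/-- The Szegő recurrence. The difference of the two sides is `X * S` with `S` of degree less than
`n` orthogonal to all polynomials of degree less than `n`, so that `P + S` is again orthogonal, and
uniqueness forces `S = 0`. -/
lemma szego_recurrence (hB : IsToeplitz B) {n : ℕ} {P P' Q : ℂ[X]} (hP : IsMonicOP B n P)
    (huniq : ∀ R, IsMonicOP B n R → R = P) (hP' : IsMonicOP B (n + 1) P')
    (hQ : IsMonicOP (OneSidedOP.conjFlip B) n Q) :
    P' = X * P + C (P'.coeff 0) * rev n Q := by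
  set R := P' - X * P - C (P'.coeff 0) * rev n Q with hR
  have hR0 : R.coeff 0 = 0 := by
    have hQn : Q.coeff n = 1 := by
      have := hQ.monic.coeff_natDegree
      rwa [hQ.natDegree_eq] at this
    simp [hR, coeff_rev, hQn]
  have hXS : R = X * R.divX := by
    conv_lhs => rw [← X_mul_divX_add R, hR0, C_0, add_zero]
  have hPd : P.degree = n := by rw [degree_eq_natDegree hP.monic.ne_zero, hP.natDegree_eq]
  have hP'd : P'.degree = (n + 1 : ℕ) := by
    rw [degree_eq_natDegree hP'.monic.ne_zero, hP'.natDegree_eq]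
  have hRd : R.degree < (n + 1 : ℕ) := by
    refine (degree_sub_le _ _).trans_lt (max_lt ?_ ?_)
    · have hd : P'.degree = (X * P).degree := by
        rw [hP'd, degree_mul, hPd, degree_X, add_comm]; rfl
      rw [← hP'd]
      refine degree_sub_lt_left hd hP'.monic.ne_zero ?_
      rw [hP'.monic.leadingCoeff, (monic_X.mul hP.monic).leadingCoeff]
    · rw [degree_lt_iff_coeff_zero]
      intro m hm
      rw [coeff_C_mul, coeff_rev_of_lt hQ.natDegree_eq.le (by omega), mul_zero]
  have hS : R.divX.degree < n := by
    rw [degree_lt_iff_coeff_zero] at hRd ⊢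
    intro m hm
    rw [coeff_divX]
    exact hRd _ (by omega)
  have horth : ∀ p : ℂ[X], p.degree < n → B R.divX p = 0 := by
    intro p hp
    have hXp : (X * p).degree < P'.degree := by
      rw [hP'd, degree_lt_iff_coeff_zero]
      intro m hm
      obtain ⟨m, rfl⟩ := Nat.exists_eq_succ_of_ne_zero (by omega : m ≠ 0)
      rw [Nat.succ_eq_add_one, coeff_X_mul]
      exact (degree_lt_iff_coeff_zero _ _).1 hp _ (by omega)
    rw [← hB.shift, ← hXS, hR, hB.sub_left, hB.sub_left, hB.smul_left, hB.shift,
      hP'.orthogonal _ hXp, hP.orthogonal p (by rwa [hPd]), hB.rev_orthogonal hQ hp]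
    simp
  have hSP : IsMonicOP B n (P + R.divX) := by
    have hdeg : R.divX.degree < P.degree := by rwa [hPd]
    refine ⟨hP.monic.add_of_left hdeg, ?_, fun p hp => ?_⟩
    · rw [natDegree_eq_of_degree_eq (degree_add_eq_left_of_degree_lt hdeg), hP.natDegree_eq]
    · rw [degree_add_eq_left_of_degree_lt hdeg] at hp
      rw [hB.add_left, hP.orthogonal p hp, horth p (by rwa [← hPd]), add_zero]
  have hzero : R.divX = 0 := by simpa using huniq _ hSP
  have : R = 0 := by rw [hXS, hzero, mul_zero]
  rw [hR] at this
  linear_combination this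

end IsToeplitz

/-! ### Systems with antisymmetric recurrence coefficients -/

/-- Left and right monic orthogonal polynomials of a normalized Toeplitz form, whose Szegő
recurrences have opposite coefficients. -/
structure SzegoSystem (B : ℂ[X] → ℂ[X] → ℂ) (P Q : ℕ → ℂ[X]) (c : ℕ → ℂ) : Prop where
  toeplitz : IsToeplitz B
  one : B 1 1 = 1
  left : ∀ n, IsMonicOP B n (P n)
  right : ∀ n, IsMonicOP (conjFlip B) n (Q n)
  rec_left : ∀ n, P (n + 1) = X * P n + C (c n) * rev n (Q n)
  rec_right : ∀ n, Q (n + 1) = X * Q n + C (-c n) * rev n (P n)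

/-- The product `∏ (1 + |c_k|²)`, which is the value of `⟨Φ_n, Φ̃_n⟩`. -/
def normProd (c : ℕ → ℂ) (n : ℕ) : ℝ := ∏ k ∈ Finset.range n, (1 + ‖c k‖ ^ 2)

lemma normProd_pos (c : ℕ → ℂ) (n : ℕ) : 0 < normProd c n :=
  Finset.prod_pos fun k _ => by positivity

lemma normProd_succ (c : ℕ → ℂ) (n : ℕ) :
    normProd c (n + 1) = normProd c n * (1 + ‖c n‖ ^ 2) := Finset.prod_range_succ _ _

namespace SzegoSystem

variable {B : ℂ[X] → ℂ[X] → ℂ} {P Q : ℕ → ℂ[X]} {c : ℕ → ℂ}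

lemma degree_left (h : SzegoSystem B P Q c) (n : ℕ) : (P n).degree = n := by
  rw [degree_eq_natDegree (h.left n).monic.ne_zero, (h.left n).natDegree_eq]

lemma degree_right (h : SzegoSystem B P Q c) (n : ℕ) : (Q n).degree = n := by
  rw [degree_eq_natDegree (h.right n).monic.ne_zero, (h.right n).natDegree_eq]

lemma left_orthogonal (h : SzegoSystem B P Q c) {n : ℕ} {p : ℂ[X]} (hp : p.degree < n) :
    B (P n) p = 0 := (h.left n).orthogonal p (by rwa [h.degree_left])

lemma right_orthogonal (h : SzegoSystem B P Q c) {n : ℕ} {p : ℂ[X]} (hp : p.degree < n) :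
    B p (Q n) = 0 := by
  have := (h.right n).orthogonal p (by rwa [h.degree_right])
  simpa [conjFlip] using this

lemma left_zero (h : SzegoSystem B P Q c) : P 0 = 1 :=
  eq_one_of_monic_natDegree_zero (h.left 0).monic (h.left 0).natDegree_eq

lemma right_zero (h : SzegoSystem B P Q c) : Q 0 = 1 :=
  eq_one_of_monic_natDegree_zero (h.right 0).monic (h.right 0).natDegree_eq

lemma degree_rev_lt {n : ℕ} {f : ℂ[X]} (hf : f.natDegree ≤ n) :
    (rev n f).degree < (n + 1 : ℕ) := by
  rw [degree_lt_iff_coeff_zero]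
  exact fun m hm => coeff_rev_of_lt hf (by omega)

lemma pairing_left_right (h : SzegoSystem B P Q c) (n : ℕ) : B (P n) (Q n) = normProd c n := by
  have hB := h.toeplitz
  induction n with
  | zero => simp [h.left_zero, h.right_zero, h.one, normProd]
  | succ n ih =>
    -- `z Φ̃_n` is `Φ̃_{n+1}`, which is orthogonal to `z ^ n Φ̃_n^*`, up to a multiple of `z ^ n Φ_n^*`.
    have h1 : B (rev n (Q n)) (X * Q n) = conj (c n) * B (P n) (Q n) := by
      have hX : X * Q n = Q (n + 1) - C (-c n) * rev n (P n) := by rw [h.rec_right]; ring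
      rw [hX, hB.sub_right, hB.smul_right,
        h.right_orthogonal (degree_rev_lt (h.right n).natDegree_eq.le),
        hB.rev_rev (h.right n).natDegree_eq.le (h.left n).natDegree_eq.le, map_neg]
      ring
    rw [h.rec_right, hB.add_right, hB.smul_right,
      h.left_orthogonal (degree_rev_lt (h.left n).natDegree_eq.le), h.rec_left, hB.add_left,
      hB.smul_left, hB.shift, h1, ih, normProd_succ]
    push_cast
    rw [← Complex.mul_conj']
    ring

/-- The reproducing kernel of the polynomials of degree less than `n`, at the point `l`, as a
polynomial in the (conjugate) variable of integration. -/
def reprPoly (P Q : ℕ → ℂ[X]) (c : ℕ → ℂ) (n : ℕ) (l : ℂ) : ℂ[X] :=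
  ∑ k ∈ Finset.range n, C (conj ((P k).eval l) / (normProd c k : ℂ)) * Q k

lemma degree_reprPoly_lt (h : SzegoSystem B P Q c) (n : ℕ) (l : ℂ) :
    (reprPoly P Q c n l).degree < n := by
  rw [degree_lt_iff_coeff_zero]
  intro m hm
  rw [reprPoly, finsetSum_coeff]
  refine Finset.sum_eq_zero fun k hk => ?_
  have hk := Finset.mem_range.1 hk
  rw [coeff_C_mul, coeff_eq_zero_of_natDegree_lt (by rw [(h.right k).natDegree_eq]; omega),
    mul_zero]

lemma reproducing (h : SzegoSystem B P Q c) (l : ℂ) (n : ℕ) :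
    ∀ p : ℂ[X], p.degree < n → B p (reprPoly P Q c n l) = p.eval l := by
  have hB := h.toeplitz
  induction n with
  | zero =>
    intro p hp
    obtain rfl : p = 0 := degree_eq_bot.1 (by simpa [Nat.WithBot.lt_zero_iff] using hp)
    have := hB.smul_left 0 0 (reprPoly P Q c 0 l)
    simpa using this
  | succ n ih =>
    intro p hp
    set a := p.coeff n
    have hq : (p - C a * P n).degree < n := by
      rw [degree_lt_iff_coeff_zero] at hp ⊢
      intro m hm
      rw [coeff_sub, coeff_C_mul]
      rcases hm.eq_or_lt with rfl | hm
      · have := (h.left n).monic.coeff_natDegree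
        rw [(h.left n).natDegree_eq] at this
        rw [this, mul_one, sub_self]
      · rw [hp m hm, coeff_eq_zero_of_natDegree_lt (by rwa [(h.left n).natDegree_eq])]
        simp
    have hpos : (normProd c n : ℂ) ≠ 0 := by exact_mod_cast (normProd_pos c n).ne'
    have hsum : reprPoly P Q c (n + 1) l = reprPoly P Q c n l +
        C (conj ((P n).eval l) / (normProd c n : ℂ)) * Q n := Finset.sum_range_succ _ _
    have hsplit : p = (p - C a * P n) + C a * P n := by ring
    rw [hsplit, hsum, hB.add_left, hB.add_right, hB.add_right, hB.smul_left, hB.smul_left,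
      hB.smul_right, hB.smul_right, ih _ hq, h.left_orthogonal (h.degree_reprPoly_lt n l),
      h.right_orthogonal hq, h.pairing_left_right]
    simp only [map_div₀, Complex.conj_conj, Complex.conj_ofReal, eval_add, eval_mul, eval_C]
    field_simp
    ring

lemma rec_rev (h : SzegoSystem B P Q c) (n : ℕ) :
    rev (n + 1) (Q (n + 1)) = rev n (Q n) - C (conj (c n)) * (X * P n) := by
  rw [h.rec_right, rev_add, rev_C_mul, rev_succ_X_mul n (h.right n).natDegree_eq.le,
    rev_succ_rev n (h.left n).natDegree_eq.le, map_neg, C_neg]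
  ring

/-- Each step of the recurrence is a unitary matrix times `diag (z, 1)`, up to normalization. -/
lemma normSq_add_normSq_le (h : SzegoSystem B P Q c) (n : ℕ) {z : ℂ} {r : ℝ} (hr : 1 ≤ r)
    (hz : ‖z‖ ≤ r) :
    ‖(P n).eval z‖ ^ 2 + ‖(rev n (Q n)).eval z‖ ^ 2 ≤ 2 * normProd c n * (r ^ n) ^ 2 := by
  induction n with
  | zero => simp [h.left_zero, h.right_zero, normProd, rev]; norm_num
  | succ n ih =>
    rw [h.rec_left, h.rec_rev, normProd_succ]
    simp only [eval_add, eval_sub, eval_mul, eval_C, eval_X]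
    set u := (P n).eval z
    set v := (rev n (Q n)).eval z
    have key : ‖z * u + c n * v‖ ^ 2 + ‖v - conj (c n) * (z * u)‖ ^ 2 =
        (1 + ‖c n‖ ^ 2) * (‖z‖ ^ 2 * ‖u‖ ^ 2 + ‖v‖ ^ 2) := by
      apply Complex.ofReal_injective
      push_cast
      simp only [← Complex.mul_conj', map_add, map_sub, map_mul, Complex.conj_conj]
      ring
    have h1 : ‖z‖ ^ 2 * ‖u‖ ^ 2 + ‖v‖ ^ 2 ≤ r ^ 2 * (‖u‖ ^ 2 + ‖v‖ ^ 2) := by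
      have h2 : ‖z‖ ^ 2 ≤ r ^ 2 := by gcongr
      have h3 : 1 ≤ r ^ 2 := one_le_pow₀ hr
      nlinarith [sq_nonneg ‖u‖, sq_nonneg ‖v‖]
    rw [key]
    calc (1 + ‖c n‖ ^ 2) * (‖z‖ ^ 2 * ‖u‖ ^ 2 + ‖v‖ ^ 2)
        ≤ (1 + ‖c n‖ ^ 2) * (r ^ 2 * (2 * normProd c n * (r ^ n) ^ 2)) := by
          gcongr
          exact h1.trans (by gcongr)
      _ = _ := by ring

/-- The cross product of the vectors `(Φ_n, z ^ n Φ̃_n^*)` at two points, normalized. -/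
def crossDet (P Q : ℕ → ℂ[X]) (c : ℕ → ℂ) (n : ℕ) (l x : ℂ) : ℂ :=
  ((P n).eval l * (rev n (Q n)).eval x - (rev n (Q n)).eval l * (P n).eval x) / (normProd c n : ℂ)

/-- The reproducing kernel `K_n(l, x) = ∑ Φ_k(l) Φ̃_k^*(x) / ⟨Φ_k, Φ̃_k⟩`. -/
def kern (P Q : ℕ → ℂ[X]) (c : ℕ → ℂ) (n : ℕ) (l x : ℂ) : ℂ :=
  conj ((reprPoly P Q c n l).eval x)

lemma kern_eq_sum (P Q : ℕ → ℂ[X]) (c : ℕ → ℂ) (n : ℕ) (l x : ℂ) :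
    kern P Q c n l x =
      ∑ k ∈ Finset.range n, (P k).eval l * conj ((Q k).eval x) / (normProd c k : ℂ) := by
  simp only [kern, reprPoly, eval_finsetSum, eval_mul, eval_C, map_sum, map_mul, map_div₀,
    Complex.conj_conj, Complex.conj_ofReal]
  exact Finset.sum_congr rfl fun k _ => by ring

lemma eval_rev_circle {n : ℕ} {f : ℂ[X]} (hf : f.natDegree ≤ n) {x : ℂ} (hx : ‖x‖ = 1) :
    (rev n f).eval x = x ^ n * conj (f.eval x) := by
  have hx0 : x ≠ 0 := norm_ne_zero_iff.1 (by rw [hx]; exact one_ne_zero)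
  rw [eval_rev hf hx0, starFn]
  have : (conj x)⁻¹ = x := by
    rw [← Complex.inv_eq_conj hx, inv_inv]
  simp only [this]

/-- The Christoffel–Darboux formula. -/
lemma christoffel_darboux (h : SzegoSystem B P Q c) (n : ℕ) (l : ℂ) {x : ℂ} (hx : ‖x‖ = 1) :
    crossDet P Q c n l x * x = x ^ n * ((l - x) * kern P Q c n l x) := by
  have hx0 : x ≠ 0 := norm_ne_zero_iff.1 (by rw [hx]; exact one_ne_zero)
  induction n with
  | zero => simp [crossDet, kern_eq_sum, h.left_zero, h.right_zero, rev]
  | succ n ih =>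
    have hn : (normProd c n : ℂ) ≠ 0 := by exact_mod_cast (normProd_pos c n).ne'
    have hc : (1 + (‖c n‖ : ℂ) ^ 2) ≠ 0 := by
      have : (1 + ‖c n‖ ^ 2 : ℝ) ≠ 0 := by positivity
      exact_mod_cast this
    have hv := eval_rev_circle (h.right n).natDegree_eq.le hx
    have hk : kern P Q c (n + 1) l x = kern P Q c n l x +
        (P n).eval l * conj ((Q n).eval x) / (normProd c n : ℂ) := by
      simp only [kern_eq_sum, Finset.sum_range_succ]
    have hstep : crossDet P Q c (n + 1) l x = x * crossDet P Q c n l x +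
        (l - x) * ((P n).eval l * (rev n (Q n)).eval x / (normProd c n : ℂ)) := by
      simp only [crossDet]
      rw [h.rec_left, h.rec_rev, normProd_succ]
      push_cast
      simp only [eval_add, eval_sub, eval_mul, eval_C, eval_X]
      field_simp
      rw [← Complex.mul_conj']
      ring
    rw [hstep, hk, hv]
    linear_combination x * ih

lemma norm_left_le (h : SzegoSystem B P Q c) (n : ℕ) {z : ℂ} {r : ℝ} (hr : 1 ≤ r) (hz : ‖z‖ ≤ r) :
    ‖(P n).eval z‖ ≤ √(2 * normProd c n) * r ^ n := by
  have hh := normProd_pos c n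
  refine le_of_sq_le_sq ?_ (by positivity)
  rw [mul_pow, Real.sq_sqrt (by positivity)]
  nlinarith [h.normSq_add_normSq_le n hr hz, sq_nonneg ‖(rev n (Q n)).eval z‖]

lemma norm_right_le (h : SzegoSystem B P Q c) (n : ℕ) {x : ℂ} (hx : ‖x‖ = 1) :
    ‖(Q n).eval x‖ ≤ √(2 * normProd c n) := by
  have hh := normProd_pos c n
  have h1 := h.normSq_add_normSq_le n le_rfl hx.le
  rw [eval_rev_circle (h.right n).natDegree_eq.le hx] at h1
  simp only [norm_mul, norm_pow, hx, one_pow, RCLike.norm_conj, one_mul, mul_one] at h1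
  refine le_of_sq_le_sq ?_ (by positivity)
  rw [Real.sq_sqrt (by positivity)]
  nlinarith [sq_nonneg ‖(P n).eval x‖]

lemma norm_crossDet_le (h : SzegoSystem B P Q c) (n : ℕ) {l x : ℂ} {r : ℝ} (hr : 1 ≤ r)
    (hl : ‖l‖ ≤ r) (hx : ‖x‖ = 1) : ‖crossDet P Q c n l x‖ ≤ 2 * r ^ n := by
  have hh := normProd_pos c n
  rw [crossDet, norm_div, Complex.norm_real, Real.norm_of_nonneg hh.le, div_le_iff₀ hh]
  have h1 := h.normSq_add_normSq_le n hr hl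
  have h2 := h.normSq_add_normSq_le n le_rfl hx.le
  rw [one_pow, one_pow, mul_one] at h2
  refine (norm_sub_le _ _).trans ?_
  rw [norm_mul, norm_mul]
  set a := ‖(P n).eval l‖
  set b := ‖(rev n (Q n)).eval l‖
  set a' := ‖(P n).eval x‖
  set b' := ‖(rev n (Q n)).eval x‖
  refine le_of_sq_le_sq ?_ (by positivity)
  calc (a * b' + b * a') ^ 2 ≤ (a ^ 2 + b ^ 2) * (a' ^ 2 + b' ^ 2) := by
        nlinarith [sq_nonneg (a * a' - b * b')]
    _ ≤ (2 * normProd c n * (r ^ n) ^ 2) * (2 * normProd c n) := by gcongr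
    _ = _ := by ring

lemma norm_kern_le (h : SzegoSystem B P Q c) (n : ℕ) {l x : ℂ} {r : ℝ} (hr : 1 ≤ r)
    (hl : ‖l‖ ≤ r) (hx : ‖x‖ = 1) : ‖kern P Q c n l x‖ ≤ 2 * r ^ n * n := by
  rw [kern_eq_sum]
  refine (norm_sum_le _ _).trans ((Finset.sum_le_card_nsmul _ _ (2 * r ^ n) fun k hk => ?_).trans ?_)
  · have hh := normProd_pos c k
    rw [norm_div, norm_mul, RCLike.norm_conj, Complex.norm_real, Real.norm_of_nonneg hh.le,
      div_le_iff₀ hh]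
    calc ‖(P k).eval l‖ * ‖(Q k).eval x‖
        ≤ (√(2 * normProd c k) * r ^ k) * √(2 * normProd c k) :=
          mul_le_mul (h.norm_left_le k hr hl) (h.norm_right_le k hx) (norm_nonneg _) (by positivity)
      _ = 2 * r ^ k * normProd c k := by
          rw [mul_right_comm, Real.mul_self_sqrt (by positivity)]; ring
      _ ≤ 2 * r ^ n * normProd c k := by
          gcongr
          exact (Finset.mem_range.1 hk).le
  · simp [mul_comm]

lemma norm_sub_mul_norm_kern (h : SzegoSystem B P Q c) (n : ℕ) (l : ℂ) {x : ℂ} (hx : ‖x‖ = 1) :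
    ‖l - x‖ * ‖kern P Q c n l x‖ = ‖crossDet P Q c n l x‖ := by
  have := congrArg norm (h.christoffel_darboux n l hx)
  simpa [hx] using this.symm

/-- Three vectors of the plane are linearly dependent. -/
lemma pluecker (P Q : ℕ → ℂ[X]) (c : ℕ → ℂ) (n : ℕ) (l s t : ℂ) :
    (P n).eval l * crossDet P Q c n s t =
      (P n).eval s * crossDet P Q c n l t - (P n).eval t * crossDet P Q c n l s := by
  simp only [crossDet]
  ring

end SzegoSystem

/-! ### Arclength and complex measures on the circle -/

instance isFiniteMeasure_arcLength : IsFiniteMeasure arcLength := by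
  unfold arcLength
  infer_instance

lemma measurable_circleExp : Measurable Circle.exp := Circle.exp.continuous.measurable

lemma integral_arcLength {f : Circle → ℂ} (hf : Continuous f) :
    ∫ x, f x ∂arcLength = ∫ θ in (-Real.pi)..Real.pi, f (Circle.exp θ) := by
  rw [arcLength, integral_map measurable_circleExp.aemeasurable hf.aestronglyMeasurable,
    intervalIntegral.integral_of_le (by linarith [Real.pi_pos])]

/-- Orthogonality of the characters of the circle. -/
lemma integral_pow_mul_conj_pow (i j : ℕ) :
    ∫ x : Circle, (x : ℂ) ^ i * conj ((x : ℂ) ^ j) ∂arcLength =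
      if i = j then ((2 * Real.pi : ℝ) : ℂ) else 0 := by
  rw [integral_arcLength (by fun_prop)]
  have h : ∀ θ : ℝ, ((Circle.exp θ : Circle) : ℂ) ^ i * conj (((Circle.exp θ : Circle) : ℂ) ^ j) =
      Complex.exp (((i : ℂ) - j) * Complex.I * θ) := by
    intro θ
    rw [Circle.coe_exp, map_pow, ← Complex.exp_conj, ← Complex.exp_nat_mul, ← Complex.exp_nat_mul,
      ← Complex.exp_add]
    congr 1
    simp only [map_mul, Complex.conj_ofReal, Complex.conj_I]
    ring
  simp only [h]
  split_ifs with hij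
  · subst hij
    simp
    ring
  · have hne : ((i : ℂ) - j) * Complex.I ≠ 0 :=
      mul_ne_zero (sub_ne_zero.2 (by exact_mod_cast hij)) Complex.I_ne_zero
    rw [integral_exp_mul_complex hne, div_eq_zero_iff]
    left
    rw [sub_eq_zero, Complex.exp_eq_exp_iff_exists_int]
    refine ⟨(i : ℤ) - j, ?_⟩
    push_cast
    ring

lemma integral_eval_mul_conj_eval {n : ℕ} {f g : ℂ[X]} (hf : f.degree < n) (hg : g.degree < n) :
    ∫ x : Circle, f.eval (x : ℂ) * conj (g.eval (x : ℂ)) ∂arcLength =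
      ((2 * Real.pi : ℝ) : ℂ) * ∑ i ∈ Finset.range n, f.coeff i * conj (g.coeff i) := by
  have hint : ∀ i j : ℕ, Integrable (fun x : Circle =>
      f.coeff i * conj (g.coeff j) * ((x : ℂ) ^ i * conj ((x : ℂ) ^ j))) arcLength := fun i j =>
    Continuous.integrable_of_hasCompactSupport (by fun_prop) (HasCompactSupport.of_compactSpace _)
  have hexp : ∀ h : ℂ[X], h.degree < n → ∀ z : ℂ,
      h.eval z = ∑ i ∈ Finset.range n, h.coeff i * z ^ i := by
    intro h hh z
    rcases eq_or_ne h 0 with rfl | h0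
    · simp
    · exact eval_eq_sum_range' ((natDegree_lt_iff_degree_lt h0).2 hh) z
  have hsum : ∀ x : Circle, f.eval (x : ℂ) * conj (g.eval (x : ℂ)) =
      ∑ i ∈ Finset.range n, ∑ j ∈ Finset.range n,
        f.coeff i * conj (g.coeff j) * ((x : ℂ) ^ i * conj ((x : ℂ) ^ j)) := by
    intro x
    rw [hexp f hf, hexp g hg, map_sum, Finset.sum_mul_sum]
    refine Finset.sum_congr rfl fun i _ => Finset.sum_congr rfl fun j _ => ?_
    rw [map_mul]
    ring
  simp only [hsum]
  rw [integral_finsetSum _ fun i _ => integrable_finsetSum _ fun j _ => hint i j, Finset.mul_sum]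
  refine Finset.sum_congr rfl fun i hi => ?_
  rw [integral_finsetSum _ fun j _ => hint i j]
  simp only [integral_const_mul, integral_pow_mul_conj_pow]
  simp only [mul_ite, mul_zero, Finset.sum_ite_eq, hi, if_true]
  ring

lemma abs_le_of_abs_sin_le {δ r : ℝ} (h₁ : -Real.pi < δ) (h₂ : δ < Real.pi)
    (h : 2 * |Real.sin δ| ≤ r) :
    |δ| ≤ Real.pi / 4 * r ∨ |δ - Real.pi| ≤ Real.pi / 4 * r ∨ |δ + Real.pi| ≤ Real.pi / 4 * r := by
  have hpi := Real.pi_pos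
  have aux : ∀ y : ℝ, |y| ≤ Real.pi / 2 → |Real.sin y| = |Real.sin δ| → |y| ≤ Real.pi / 4 * r := by
    intro y hy hsin
    have h3 := Real.mul_abs_le_abs_sin hy
    rw [hsin] at h3
    have h4 : |y| = Real.pi / 4 * (2 * (2 / Real.pi * |y|)) := by field_simp; norm_num
    rw [h4]
    gcongr
    linarith
  rcases le_or_gt |δ| (Real.pi / 2) with hd | hd
  · exact Or.inl (aux δ hd rfl)
  · rcases lt_abs.1 hd with hd | hd
    · refine Or.inr (Or.inl (aux _ ?_ ?_))
      · rw [abs_le]; constructor <;> linarith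
      · rw [Real.sin_sub_pi, abs_neg]
    · refine Or.inr (Or.inr (aux _ ?_ ?_))
      · rw [abs_le]; constructor <;> linarith
      · rw [Real.sin_add_pi, abs_neg]

/-- In the parameter `θ ∈ (-π, π]`, a ball around `exp (i a)` is covered by three intervals, around
`a` and `a ± 2π`. -/
lemma arcLength_closedBall_le (s : Circle) {r : ℝ} (hr : 0 ≤ r) :
    arcLength (Metric.closedBall s r) ≤ ENNReal.ofReal (3 * Real.pi * r) := by
  have hpi := Real.pi_pos
  obtain ⟨a, ha, rfl⟩ : ∃ a : ℝ, a ∈ Set.Ioc (-Real.pi) Real.pi ∧ Circle.exp a = s :=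
    ⟨Complex.arg s, ⟨Complex.neg_pi_lt_arg _, Complex.arg_le_pi _⟩, Circle.exp_arg s⟩
  have hdist : ∀ θ : ℝ, dist (Circle.exp θ) (Circle.exp a) = 2 * |Real.sin ((θ - a) / 2)| := by
    intro θ
    have h1 : ((Circle.exp θ : Circle) : ℂ) - (Circle.exp a : Circle) =
        (Circle.exp a : Circle) * (Complex.exp (Complex.I * ((θ - a : ℝ) : ℂ)) - 1) := by
      rw [Circle.coe_exp, Circle.coe_exp, mul_sub, ← Complex.exp_add, mul_one]
      congr 2
      push_cast
      ring
    change dist ((Circle.exp θ : Circle) : ℂ) ((Circle.exp a : Circle) : ℂ) = _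
    rw [dist_eq_norm, h1, norm_mul, Circle.norm_coe, one_mul,
      Complex.norm_exp_I_mul_ofReal_sub_one, norm_mul, Real.norm_eq_abs, Real.norm_eq_abs, abs_two]
  have hsub : Circle.exp ⁻¹' Metric.closedBall (Circle.exp a) r ∩ Set.Ioc (-Real.pi) Real.pi ⊆
      Metric.closedBall a (Real.pi / 2 * r) ∪ (Metric.closedBall (a + 2 * Real.pi) (Real.pi / 2 * r) ∪
        Metric.closedBall (a - 2 * Real.pi) (Real.pi / 2 * r)) := by
    rintro θ ⟨hθ, hθ1, hθ2⟩
    rw [Set.mem_preimage, Metric.mem_closedBall, hdist] at hθ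
    rcases abs_le_of_abs_sin_le (by linarith [ha.2]) (by linarith [ha.1]) hθ with h | h | h
    · left
      rw [Metric.mem_closedBall, Real.dist_eq, show θ - a = 2 * ((θ - a) / 2) by ring, abs_mul,
        abs_two]
      linarith
    · right; left
      rw [Metric.mem_closedBall, Real.dist_eq,
        show θ - (a + 2 * Real.pi) = 2 * ((θ - a) / 2 - Real.pi) by ring, abs_mul, abs_two]
      linarith
    · right; right
      rw [Metric.mem_closedBall, Real.dist_eq,
        show θ - (a - 2 * Real.pi) = 2 * ((θ - a) / 2 + Real.pi) by ring, abs_mul, abs_two]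
      linarith
  rw [arcLength, Measure.map_apply measurable_circleExp measurableSet_closedBall,
    Measure.restrict_apply (measurable_circleExp measurableSet_closedBall)]
  refine (measure_mono hsub).trans ((measure_union_le _ _).trans
    ((add_le_add le_rfl (measure_union_le _ _)).trans ?_))
  simp only [Real.volume_closedBall]
  rw [← ENNReal.ofReal_add (by positivity) (by positivity),
    ← ENNReal.ofReal_add (by positivity) (by positivity)]
  exact ENNReal.ofReal_le_ofReal (by linarith)

/-- The variation of a complex measure is dominated by those of its real and imaginary parts. -/
instance isFiniteMeasure_variation {α : Type*} [MeasurableSpace α] (c : ComplexMeasure α) :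
    IsFiniteMeasure c.variation := by
  have h : c.variation ≤ c.re.totalVariation + c.im.totalVariation := by
    refine VectorMeasure.variation_le_of_forall_enorm_le fun E hE => ?_
    rw [Measure.add_apply]
    refine le_trans ?_ (add_le_add (SignedMeasure.enorm_le_totalVariation c.re E)
      (SignedMeasure.enorm_le_totalVariation c.im E))
    have h1 : c E = ((c.re E : ℝ) : ℂ) + ((c.im E : ℝ) : ℂ) * Complex.I := (Complex.re_add_im _).symm
    rw [h1]
    refine (enorm_add_le _ _).trans (le_of_eq ?_)
    rw [enorm_mul]
    simp [← ofReal_norm]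
  have : IsFiniteMeasure (c.re.totalVariation + c.im.totalVariation) := by
    unfold SignedMeasure.totalVariation
    infer_instance
  exact isFiniteMeasure_of_le _ h

lemma integrable_variation {μ : ComplexMeasure Circle} {f : Circle → ℂ} (hf : Continuous f) :
    μ.Integrable f :=
  hf.integrable_of_hasCompactSupport (HasCompactSupport.of_compactSpace _)

lemma integral_const_mul_vectorMeasure (μ : ComplexMeasure Circle) (c : ℂ) (f : Circle → ℂ) :
    μ.integral (fun x => c * f x) (ContinuousLinearMap.mul ℝ ℂ) =
      c * μ.integral f (ContinuousLinearMap.mul ℝ ℂ) := by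
  refine setToFun_smul _ (fun a E x => ?_) c f
  simp [VectorMeasure.transpose, mul_left_comm]

lemma enorm_integral_le (μ : ComplexMeasure Circle) (f : Circle → ℂ) :
    ‖μ.integral f (ContinuousLinearMap.mul ℝ ℂ)‖ₑ ≤ ∫⁻ x, ‖f x‖ₑ ∂μ.variation := by
  refine VectorMeasure.enorm_integral_le_lintegral_enorm.trans ?_
  have : ‖ContinuousLinearMap.mul ℝ ℂ‖ₑ ≤ 1 := by
    rw [← ofReal_norm]
    exact ENNReal.ofReal_le_one.2 (ContinuousLinearMap.opNorm_mul_le ℝ ℂ)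
  exact mul_le_of_le_one_left' this

lemma integral_withDensity_const (c : ℂ) {f : Circle → ℂ} (hf : Integrable f arcLength) :
    VectorMeasure.integral (arcLength.withDensityᵥ fun _ : Circle => c) f
      (ContinuousLinearMap.mul ℝ ℂ) = (∫ x, f x ∂arcLength) * c := by
  have hV : (arcLength.withDensityᵥ fun _ : Circle => c).variation = ‖c‖ₑ • arcLength := by
    rw [Measure.variation_withDensityᵥ (integrable_const c), withDensity_const]
  have hint : ∀ {f : Circle → ℂ}, Integrable f arcLength →
      (arcLength.withDensityᵥ fun _ : Circle => c).Integrable f := by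
    intro f hf
    rw [VectorMeasure.Integrable, hV]
    exact hf.smul_measure enorm_ne_top
  have hV' : IsFiniteMeasure (arcLength.withDensityᵥ fun _ : Circle => c).variation := by
    rw [hV]
    exact ⟨by simpa using ENNReal.mul_lt_top enorm_lt_top (measure_lt_top arcLength Set.univ)⟩
  refine Integrable.induction (fun f : Circle → ℂ =>
    VectorMeasure.integral (arcLength.withDensityᵥ fun _ : Circle => c) f
      (ContinuousLinearMap.mul ℝ ℂ) = (∫ x, f x ∂arcLength) * c) ?_ ?_ ?_ ?_ hf
  · intro a E hE _
    rw [VectorMeasure.integral_indicator_const a hE, integral_indicator_const a hE,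
      withDensityᵥ_apply (integrable_const c) hE, setIntegral_const]
    simp only [ContinuousLinearMap.mul_apply', Complex.real_smul]
    ring
  · intro f g _ hf hg ihf ihg
    rw [VectorMeasure.integral_add (hint hf) (hint hg), ihf, ihg, integral_add' hf hg, add_mul]
  · refine isClosed_eq ?_ (continuous_integral.mul continuous_const)
    refine continuous_iff_continuousAt.2 fun f => ?_
    refine VectorMeasure.tendsto_integral_of_L1 _ (hint (L1.integrable_coeFn f)).1
      (Eventually.of_forall fun g => hint (L1.integrable_coeFn g)) ?_
    have h1 : Tendsto (fun g : Circle →₁[arcLength] ℂ => ‖c‖ₑ * edist g f) (𝓝 f) (𝓝 0) := by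
      have := ENNReal.Tendsto.const_mul (a := ‖c‖ₑ) (tendsto_iff_edist_tendsto_0.1
        (tendsto_id : Tendsto id (𝓝 f) (𝓝 f))) (Or.inr enorm_ne_top)
      simpa using this
    refine h1.congr fun g => ?_
    rw [hV, lintegral_smul_measure, smul_eq_mul, L1.edist_def]
    simp only [edist_eq_enorm_sub]
  · intro f g hfg _ ih
    rw [← integral_congr_ae hfg, ← ih]
    refine (VectorMeasure.integral_congr_ae ?_).symm
    rw [hV]
    exact Measure.smul_absolutelyContinuous.ae_le hfg

/-! ### Concentration at a regular point -/

/-- If a finite measure `m` gives mass `o(r)` to the ball of radius `r` at `s`, then functions which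
are bounded by `n * min (1, 1 / (n d) ^ 2)`, `d` the distance to `s`, have small integrals. -/
lemma lintegral_small_of_density_zero {X : Type*} [PseudoMetricSpace X] [MeasurableSpace X]
    [OpensMeasurableSpace X] {m : Measure X} [IsFiniteMeasure m] {s : X}
    (hm : Tendsto (fun r : ℝ => m.real (Metric.closedBall s r) / r) (𝓝[>] 0) (𝓝 0))
    {L η : ℝ} (hL : 0 ≤ L) (hη : 0 < η) :
    ∀ᶠ n : ℕ in atTop, ∀ f : X → ℂ, (∀ x, ‖f x‖ ≤ L * n) →
      (∀ x, ‖f x‖ * (n * dist x s ^ 2) ≤ L) → ∫⁻ x, ‖f x‖ₑ ∂m ≤ ENNReal.ofReal η := by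
  -- `T n j` bounds the contribution of the dyadic shell `d ≈ 2 ^ j / n`.
  set T : ℕ → ℕ → ℝ := fun n j =>
    L * 4 * (1 / 2) ^ j * (m.real (Metric.closedBall s (2 ^ j / n)) / (2 ^ j / n)) with hT
  have hTnn : ∀ n j, 0 ≤ T n j := fun n j => by positivity
  obtain ⟨M, hM⟩ : ∃ M : ℝ, ∀ r : ℝ, 0 < r → m.real (Metric.closedBall s r) / r ≤ M := by
    obtain ⟨δ, hδ, h⟩ := mem_nhdsGT_iff_exists_Ioo_subset.1 (hm.eventually (gt_mem_nhds one_pos))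
    have hδ : 0 < δ := hδ
    refine ⟨max 1 (m.real Set.univ / δ), fun r hr => ?_⟩
    rcases lt_or_ge r δ with hrδ | hrδ
    · exact le_max_of_le_left (le_of_lt (h ⟨hr, hrδ⟩))
    · refine le_max_of_le_right ?_
      exact div_le_div₀ measureReal_nonneg (measureReal_mono (Set.subset_univ _)) hδ hrδ
  have hTle : ∀ n : ℕ, 0 < n → ∀ j, T n j ≤ L * 4 * (1 / 2) ^ j * M := by
    intro n hn j
    have : (0 : ℝ) < n := by exact_mod_cast hn
    exact mul_le_mul_of_nonneg_left (hM _ (by positivity)) (by positivity)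
  have hbs : Summable fun j : ℕ => L * 4 * (1 / 2 : ℝ) ^ j * M :=
    (summable_geometric_two.mul_left _).mul_right _
  have hlim : Tendsto (fun n : ℕ => ∑' j, T n j) atTop (𝓝 0) := by
    have h0 : (0 : ℝ) = ∑' _ : ℕ, (0 : ℝ) := by simp
    rw [h0]
    refine tendsto_tsum_of_dominated_convergence (bound := fun j : ℕ => L * 4 * (1 / 2 : ℝ) ^ j * M)
      hbs (fun j => ?_) ?_
    · have h1 : Tendsto (fun n : ℕ => (2 : ℝ) ^ j / n) atTop (𝓝[>] 0) := by
        refine tendsto_nhdsWithin_iff.2 ⟨tendsto_const_div_atTop_nhds_zero_nat _, ?_⟩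
        filter_upwards [eventually_gt_atTop 0] with n hn
        have : (0 : ℝ) < n := by exact_mod_cast hn
        exact Set.mem_Ioi.2 (by positivity)
      have := (hm.comp h1).const_mul (L * 4 * (1 / 2) ^ j)
      rwa [mul_zero] at this
    · filter_upwards [eventually_gt_atTop 0] with n hn j
      rw [Real.norm_of_nonneg (hTnn n j)]
      exact hTle n hn j
  filter_upwards [hlim.eventually (gt_mem_nhds hη), eventually_gt_atTop 0] with n hn hn0 f hf1 hf2
  have hn0' : (0 : ℝ) < n := by exact_mod_cast hn0
  have hpt : ∀ x, ‖f x‖ₑ ≤ ∑' j : ℕ, ENNReal.ofReal (L * n * 4 * (1 / 4) ^ j) *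
      (Metric.closedBall s (2 ^ j / n)).indicator 1 x := by
    intro x
    obtain ⟨j, hj1, hj2⟩ : ∃ j : ℕ, dist x s ≤ 2 ^ j / n ∧ ‖f x‖ ≤ L * n * 4 * (1 / 4) ^ j := by
      rcases le_or_gt (n * dist x s) 1 with h | h
      · refine ⟨0, ?_, ?_⟩
        · rw [pow_zero, le_div_iff₀ hn0']
          linarith
        · have := hf1 x
          have : 0 ≤ L * n := by positivity
          rw [pow_zero]
          linarith
      · obtain ⟨k, hk1, hk2⟩ := exists_nat_pow_near h.le one_lt_two
        refine ⟨k + 1, ?_, ?_⟩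
        · rw [le_div_iff₀ hn0']
          linarith
        · have h4 : (4 : ℝ) ^ k ≤ (n * dist x s) ^ 2 := by
            rw [show (4 : ℝ) ^ k = (2 ^ k) ^ 2 by rw [← pow_mul, mul_comm, pow_mul]; norm_num]
            gcongr
          have h5 : ‖f x‖ * 4 ^ k ≤ L * n := by
            calc ‖f x‖ * 4 ^ k ≤ ‖f x‖ * (n * dist x s) ^ 2 := by gcongr
              _ = ‖f x‖ * (n * dist x s ^ 2) * n := by ring
              _ ≤ L * n := by gcongr; exact hf2 x
          rw [show L * n * 4 * (1 / 4) ^ (k + 1) = L * n / 4 ^ k by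
            rw [pow_succ, one_div, inv_pow]; field_simp, le_div_iff₀ (by positivity)]
          exact h5
    refine le_trans ?_ (ENNReal.le_tsum j)
    rw [Set.indicator_of_mem (Metric.mem_closedBall.2 hj1), Pi.one_apply, mul_one, ← ofReal_norm]
    exact ENNReal.ofReal_le_ofReal hj2
  calc ∫⁻ x, ‖f x‖ₑ ∂m
      ≤ ∫⁻ x, ∑' j : ℕ, ENNReal.ofReal (L * n * 4 * (1 / 4) ^ j) *
          (Metric.closedBall s (2 ^ j / n)).indicator 1 x ∂m := lintegral_mono hpt
    _ = ∑' j : ℕ, ENNReal.ofReal (T n j) := by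
        have hmeas : ∀ j : ℕ, Measurable ((Metric.closedBall s (2 ^ j / (n : ℝ))).indicator
            (1 : X → ENNReal)) := fun j =>
          measurable_one.indicator Metric.isClosed_closedBall.measurableSet
        rw [lintegral_tsum fun j => ((hmeas j).const_mul _).aemeasurable]
        refine tsum_congr fun j => ?_
        rw [lintegral_const_mul _ (hmeas j),
          lintegral_indicator_one Metric.isClosed_closedBall.measurableSet,
          ← ofReal_measureReal, ← ENNReal.ofReal_mul (by positivity)]
        congr 1
        rw [hT]
        have h4 : (4 : ℝ) ^ j = (2 ^ j) ^ 2 := by rw [← pow_mul, mul_comm, pow_mul]; norm_num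
        simp only [one_div, inv_pow, h4]
        field_simp
    _ = ENNReal.ofReal (∑' j, T n j) :=
        (ENNReal.ofReal_tsum_of_nonneg (hTnn n)
          (hbs.of_nonneg_of_le (hTnn n) (hTle n hn0))).symm
    _ ≤ ENNReal.ofReal η := ENNReal.ofReal_le_ofReal hn.le

/-- The difference of `μ` and the multiple of arclength by the value of its density at `s`. -/
def remainder (μ : ComplexMeasure Circle) (w : Circle → ℂ) (s : Circle) : ComplexMeasure Circle :=
  μ - arcLength.withDensityᵥ fun _ => w s / ((2 * Real.pi : ℝ) : ℂ)

lemma tendsto_remainder {μ : ComplexMeasure Circle} {w : Circle → ℂ} (hw : IsDensity μ w)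
    {s : Circle} (hs : s ∈ regularSet μ w) :
    Tendsto (fun r : ℝ => (remainder μ w s).variation.real (Metric.closedBall s r) / r)
      (𝓝[>] 0) (𝓝 0) := by
  obtain ⟨hs1, hs2⟩ := hs
  set a : ℂ := w s / ((2 * Real.pi : ℝ) : ℂ)
  set g : Circle → ℂ := fun y => w y / ((2 * Real.pi : ℝ) : ℂ)
  have hg : Integrable g arcLength := (μ.integrable_rnDeriv arcLength).congr hw.symm
  have hga : Integrable (fun y => g y - a) arcLength := hg.sub (integrable_const a)
  have hdec : remainder μ w s =
      μ.singularPart arcLength + arcLength.withDensityᵥ (fun y => g y - a) := by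
    have : μ.HaveLebesgueDecomposition arcLength := ⟨inferInstance, inferInstance⟩
    have h1 := ComplexMeasure.singularPart_add_withDensity_rnDeriv_eq (c := μ) (μ := arcLength)
    rw [remainder, withDensityᵥ_sub' hg (integrable_const a), WithDensityᵥEq.congr_ae hw, ← add_sub_assoc,
      h1]
  have hvar : (remainder μ w s).variation ≤ (μ.singularPart arcLength).variation +
      arcLength.withDensity (fun y => ‖g y - a‖ₑ) := by
    rw [hdec, ← Measure.variation_withDensityᵥ hga]
    exact VectorMeasure.variation_add_le
  obtain ⟨U, hU, hU0⟩ := Measure.notMem_support_iff_exists.1 hs1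
  obtain ⟨δ, hδ, hδU⟩ := Metric.nhds_basis_closedBall.mem_iff.1 hU
  have hbound : ∀ᶠ r : ℝ in 𝓝[>] 0,
      (remainder μ w s).variation.real (Metric.closedBall s r) / r ≤
        3 * Real.pi * ⨍ y in Metric.closedBall s r, ‖g y - a‖ ∂arcLength := by
    filter_upwards [Ioo_mem_nhdsGT hδ] with r hr
    have hr0 : 0 < r := hr.1
    have hsing : (μ.singularPart arcLength).variation (Metric.closedBall s r) = 0 :=
      measure_mono_null ((Metric.closedBall_subset_closedBall hr.2.le).trans hδU) hU0
    have h1 : (remainder μ w s).variation (Metric.closedBall s r) ≤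
        ENNReal.ofReal (∫ y in Metric.closedBall s r, ‖g y - a‖ ∂arcLength) := by
      refine (hvar _).trans ?_
      rw [Measure.add_apply, hsing, zero_add, withDensity_apply _ measurableSet_closedBall,
        ofReal_integral_norm_eq_lintegral_enorm hga.integrableOn]
    have h2 : (remainder μ w s).variation.real (Metric.closedBall s r) ≤
        ∫ y in Metric.closedBall s r, ‖g y - a‖ ∂arcLength :=
      ENNReal.toReal_le_of_le_ofReal (integral_nonneg fun _ => norm_nonneg _) h1
    have h3 : ∫ y in Metric.closedBall s r, ‖g y - a‖ ∂arcLength =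
        arcLength.real (Metric.closedBall s r) *
          ⨍ y in Metric.closedBall s r, ‖g y - a‖ ∂arcLength := by
      have := measure_smul_setAverage (μ := arcLength) (fun y => ‖g y - a‖)
        (measure_ne_top arcLength (Metric.closedBall s r))
      rw [← this, smul_eq_mul]
    have h4 : arcLength.real (Metric.closedBall s r) ≤ 3 * Real.pi * r :=
      ENNReal.toReal_le_of_le_ofReal (by positivity) (arcLength_closedBall_le s hr0.le)
    have h5 : 0 ≤ ⨍ y in Metric.closedBall s r, ‖g y - a‖ ∂arcLength :=
      integral_nonneg fun _ => norm_nonneg _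
    rw [div_le_iff₀ hr0]
    calc _ ≤ _ := h2
      _ = _ := h3
      _ ≤ 3 * Real.pi * r * ⨍ y in Metric.closedBall s r, ‖g y - a‖ ∂arcLength := by gcongr
      _ = _ := by ring
  refine squeeze_zero' ?_ hbound ?_
  · filter_upwards [self_mem_nhdsWithin] with r hr
    have : (0 : ℝ) < r := hr
    positivity
  · have := hs2.const_mul (3 * Real.pi)
    rwa [mul_zero] at this

/-- Near a regular point the measure may be replaced by a multiple of arclength, when integrating
functions concentrated at scale `1 / n`. -/
lemma integral_approx {μ : ComplexMeasure Circle} {w : Circle → ℂ} (hw : IsDensity μ w)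
    {s : Circle} (hs : s ∈ regularSet μ w) {L η : ℝ} (hL : 0 ≤ L) (hη : 0 < η) :
    ∀ᶠ n : ℕ in atTop, ∀ f : Circle → ℂ, Continuous f → (∀ x, ‖f x‖ ≤ L * n) →
      (∀ x, ‖f x‖ * (n * dist x s ^ 2) ≤ L) →
      ‖μ.integral f (ContinuousLinearMap.mul ℝ ℂ) -
        (∫ x, f x ∂arcLength) * (w s / ((2 * Real.pi : ℝ) : ℂ))‖ ≤ η := by
  filter_upwards [lintegral_small_of_density_zero (tendsto_remainder hw hs) hL hη]
    with n hn f hfc hf1 hf2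
  have h1 : μ.integral f (ContinuousLinearMap.mul ℝ ℂ) -
      (∫ x, f x ∂arcLength) * (w s / ((2 * Real.pi : ℝ) : ℂ)) =
      (remainder μ w s).integral f (ContinuousLinearMap.mul ℝ ℂ) := by
    rw [remainder, VectorMeasure.integral_sub_vectorMeasure (integrable_variation hfc)
      (integrable_variation hfc), integral_withDensity_const _
      (hfc.integrable_of_hasCompactSupport (HasCompactSupport.of_compactSpace _))]
  have h2 := (enorm_integral_le (remainder μ w s) f).trans (hn f hf1 hf2)
  rw [h1]
  rwa [← ofReal_norm, ENNReal.ofReal_le_ofReal_iff hη.le] at h2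

/-! ### The orthogonal polynomials of a measure in the class `𝒯₋` -/

section system

variable {μ : ComplexMeasure Circle}

lemma starFn_coe (f : ℂ → ℂ) (z : Circle) : starFn f (z : ℂ) = conj (f z) := by
  rw [starFn, ← Complex.inv_eq_conj z.norm_coe, inv_inv]

lemma coe_mul_conj_coe (z : Circle) : (z : ℂ) * conj (z : ℂ) = 1 := by
  rw [Complex.mul_conj', Circle.norm_coe]
  norm_num

lemma pairing_eq (μ : ComplexMeasure Circle) (f g : ℂ[X]) :
    pairing μ f g = μ.integral (fun z : Circle => f.eval (z : ℂ) * conj (g.eval (z : ℂ)))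
      (ContinuousLinearMap.mul ℝ ℂ) := by
  simp only [pairing, starFn_coe]

lemma isToeplitz_pairing (μ : ComplexMeasure Circle) : IsToeplitz (pairing μ) where
  add_left f₁ f₂ g := by
    simp only [pairing_eq, eval_add, add_mul]
    exact VectorMeasure.integral_fun_add (integrable_variation (by fun_prop))
      (integrable_variation (by fun_prop))
  smul_left c f g := by
    simp only [pairing_eq, eval_mul, eval_C, mul_assoc]
    exact integral_const_mul_vectorMeasure μ c _
  add_right f g₁ g₂ := by
    simp only [pairing_eq, eval_add, map_add, mul_add]
    exact VectorMeasure.integral_fun_add (integrable_variation (by fun_prop))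
      (integrable_variation (by fun_prop))
  smul_right c f g := by
    simp only [pairing_eq, eval_mul, eval_C, map_mul]
    rw [← integral_const_mul_vectorMeasure]
    congr 1
    funext z
    ring
  shift f g := by
    simp only [pairing_eq, eval_mul, eval_X, map_mul]
    congr 1
    funext z
    have hz : (z : ℂ) * conj (z : ℂ) = 1 := coe_mul_conj_coe _
    linear_combination f.eval (z : ℂ) * conj (g.eval (z : ℂ)) * hz

lemma isLeftMonicOP_iff {n : ℕ} {P : ℂ[X]} :
    IsLeftMonicOP μ n P ↔ IsMonicOP (pairing μ) n P :=
  ⟨fun h => ⟨h.1, h.2, h.3⟩, fun h => ⟨h.1, h.2, h.3⟩⟩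

lemma isRightMonicOP_iff {n : ℕ} {P : ℂ[X]} :
    IsRightMonicOP μ n P ↔ IsMonicOP (conjFlip (pairing μ)) n P :=
  ⟨fun h => ⟨h.1, h.2, fun p hp => by simp [conjFlip, h.3 p hp]⟩,
    fun h => ⟨h.1, h.2, fun p hp => by simpa [conjFlip] using h.3 p hp⟩⟩

lemma isMonicOP_leftMonic (hμ : ClassT μ) (n : ℕ) : IsMonicOP (pairing μ) n (leftMonic μ n) := by
  have h := (hμ.left n).exists
  rw [leftMonic, dif_pos h]
  exact isLeftMonicOP_iff.1 h.choose_spec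

lemma isMonicOP_rightMonic (hμ : ClassT μ) (n : ℕ) :
    IsMonicOP (conjFlip (pairing μ)) n (rightMonic μ n) := by
  have h := (hμ.right n).exists
  rw [rightMonic, dif_pos h]
  exact isRightMonicOP_iff.1 h.choose_spec

lemma szegoRel_iff {P' P Q : ℂ[X]} {n : ℕ} (hQ : Q.natDegree ≤ n) (c : ℂ) :
    SzegoRel P' P Q n c ↔ P' = X * P + C (conj c) * rev n Q := by
  constructor
  · intro h
    have h0 : X * (P' - X * P - C (conj c) * rev n Q) = 0 := by
      refine Polynomial.funext fun z => ?_
      rcases eq_or_ne z 0 with rfl | hz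
      · simp
      · have := h z hz
        rw [mul_assoc, ← eval_rev hQ hz] at this
        simp only [eval_mul, eval_sub, eval_X, eval_C, eval_zero]
        rw [this, sub_self, mul_zero]
    have h1 := (mul_eq_zero.1 h0).resolve_left X_ne_zero
    linear_combination h1
  · rintro rfl z hz
    rw [mul_assoc, ← eval_rev hQ hz]
    simp only [eval_add, eval_mul, eval_X, eval_C]
    ring

lemma leftMonic_succ (hμ : ClassT μ) (n : ℕ) :
    leftMonic μ (n + 1) =
      X * leftMonic μ n + C (conj (leftCoeff μ (n + 1))) * rev n (rightMonic μ n) := by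
  have hQ := isMonicOP_rightMonic hμ n
  have hex : ∃ c, SzegoRel (leftMonic μ (n + 1)) (leftMonic μ n) (rightMonic μ n) n c := by
    refine ⟨conj ((leftMonic μ (n + 1)).coeff 0), (szegoRel_iff hQ.natDegree_eq.le _).2 ?_⟩
    rw [Complex.conj_conj]
    exact (isToeplitz_pairing μ).szego_recurrence (isMonicOP_leftMonic hμ n)
      (fun R hR => (hμ.left n).unique (isLeftMonicOP_iff.2 hR)
        (isLeftMonicOP_iff.2 (isMonicOP_leftMonic hμ n))) (isMonicOP_leftMonic hμ (n + 1)) hQ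
  rw [leftCoeff, dif_pos hex]
  exact (szegoRel_iff hQ.natDegree_eq.le _).1 hex.choose_spec

lemma conjFlip_conjFlip (B : ℂ[X] → ℂ[X] → ℂ) : conjFlip (conjFlip B) = B := by
  funext f g
  simp [conjFlip]

lemma rightMonic_succ (hμ : ClassT μ) (n : ℕ) :
    rightMonic μ (n + 1) =
      X * rightMonic μ n + C (conj (rightCoeff μ (n + 1))) * rev n (leftMonic μ n) := by
  have hP := isMonicOP_leftMonic hμ n
  have hex : ∃ c, SzegoRel (rightMonic μ (n + 1)) (rightMonic μ n) (leftMonic μ n) n c := by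
    refine ⟨conj ((rightMonic μ (n + 1)).coeff 0), (szegoRel_iff hP.natDegree_eq.le _).2 ?_⟩
    rw [Complex.conj_conj]
    exact (isToeplitz_pairing μ).conjFlip.szego_recurrence (isMonicOP_rightMonic hμ n)
      (fun R hR => (hμ.right n).unique (isRightMonicOP_iff.2 hR)
        (isRightMonicOP_iff.2 (isMonicOP_rightMonic hμ n))) (isMonicOP_rightMonic hμ (n + 1))
      (by rwa [conjFlip_conjFlip])
  rw [rightCoeff, dif_pos hex]
  exact (szegoRel_iff hP.natDegree_eq.le _).1 hex.choose_spec

/-- The recurrence coefficients `conj F_{n+1}`, indexed from zero. -/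
def szegoCoeff (μ : ComplexMeasure Circle) (n : ℕ) : ℂ := conj (leftCoeff μ (n + 1))

lemma szegoSystem (hμ : ClassTMinus μ) :
    SzegoSystem (pairing μ) (leftMonic μ) (rightMonic μ) (szegoCoeff μ) where
  toeplitz := isToeplitz_pairing μ
  one := by
    simp only [pairing_eq, eval_one, map_one, mul_one]
    rw [VectorMeasure.integral_const, hμ.mass_one]
    simp
  left := isMonicOP_leftMonic hμ.toClassT
  right := isMonicOP_rightMonic hμ.toClassT
  rec_left := leftMonic_succ hμ.toClassT
  rec_right n := by
    rw [rightMonic_succ hμ.toClassT, szegoCoeff, hμ.coeff_eq_neg (n + 1) (by omega), ← map_neg,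
      neg_neg]

lemma eval_phi (hμ : ClassTMinus μ) (n : ℕ) (z : ℂ) :
    (phi μ n).eval z =
      ((√(normProd (szegoCoeff μ) n) : ℝ) : ℂ)⁻¹ * (leftMonic μ n).eval z := by
  rw [phi, (szegoSystem hμ).pairing_left_right, Complex.ofReal_re, eval_mul, eval_C]

lemma norm_phi_le (hμ : ClassTMinus μ) (n : ℕ) {z : ℂ} {r : ℝ} (hr : 1 ≤ r) (hz : ‖z‖ ≤ r) :
    ‖(phi μ n).eval z‖ ≤ √2 * r ^ n := by
  have hh := Real.sqrt_pos.2 (normProd_pos (szegoCoeff μ) n)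
  rw [eval_phi hμ, norm_mul, norm_inv, Complex.norm_real, Real.norm_of_nonneg hh.le,
    inv_mul_le_iff₀ hh]
  refine ((szegoSystem hμ).norm_left_le n hr hz).trans (le_of_eq ?_)
  rw [Real.sqrt_mul zero_le_two]
  ring

/-- The normalized cross product of two solution vectors, for the measure `μ`. -/
abbrev measDet (μ : ComplexMeasure Circle) (n : ℕ) (l x : ℂ) : ℂ :=
  SzegoSystem.crossDet (leftMonic μ) (rightMonic μ) (szegoCoeff μ) n l x

lemma phi_mul_measDet (hμ : ClassTMinus μ) (n : ℕ) (l s t : ℂ) :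
    (phi μ n).eval l * measDet μ n s t =
      (phi μ n).eval s * measDet μ n l t - (phi μ n).eval t * measDet μ n l s := by
  simp only [eval_phi hμ]
  rw [mul_assoc, SzegoSystem.pluecker]
  ring

/-- On the circle both components of the normalized vector are at most `√2`, which bounds the
cross product by the values of `φ_n`. -/
lemma norm_measDet_le (hμ : ClassTMinus μ) (n : ℕ) {s t : ℂ} (hs : ‖s‖ = 1) (ht : ‖t‖ = 1) :
    ‖measDet μ n s t‖ ≤ 2 * (‖(phi μ n).eval s‖ + ‖(phi μ n).eval t‖) := by
  have hpos := normProd_pos (szegoCoeff μ) n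
  have hh := Real.sqrt_pos.2 hpos
  have hv : ∀ x : ℂ, ‖x‖ = 1 →
      ‖(rev n (rightMonic μ n)).eval x‖ ≤ 2 * √(normProd (szegoCoeff μ) n) := by
    intro x hx
    rw [SzegoSystem.eval_rev_circle ((szegoSystem hμ).right n).natDegree_eq.le hx, norm_mul,
      norm_pow, hx, one_pow, one_mul, RCLike.norm_conj]
    refine ((szegoSystem hμ).norm_right_le n hx).trans ?_
    rw [Real.sqrt_mul zero_le_two]
    gcongr
    rw [Real.sqrt_le_left zero_le_two]
    norm_num
  have hu : ∀ x : ℂ, ‖(leftMonic μ n).eval x‖ =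
      √(normProd (szegoCoeff μ) n) * ‖(phi μ n).eval x‖ := by
    intro x
    rw [eval_phi hμ, norm_mul, norm_inv, Complex.norm_real, Real.norm_of_nonneg hh.le,
      mul_inv_cancel_left₀ hh.ne']
  rw [measDet, SzegoSystem.crossDet, norm_div, Complex.norm_real, Real.norm_of_nonneg hpos.le,
    div_le_iff₀ hpos]
  refine (norm_sub_le _ _).trans ?_
  rw [norm_mul, norm_mul, hu, hu]
  calc _ ≤ √(normProd (szegoCoeff μ) n) * ‖(phi μ n).eval s‖ * (2 * √(normProd (szegoCoeff μ) n)) +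
        (2 * √(normProd (szegoCoeff μ) n)) * (√(normProd (szegoCoeff μ) n) * ‖(phi μ n).eval t‖) := by
        gcongr
        exacts [hv t ht, hv s hs]
    _ = √(normProd (szegoCoeff μ) n) * √(normProd (szegoCoeff μ) n) *
        (2 * (‖(phi μ n).eval s‖ + ‖(phi μ n).eval t‖)) := by ring
    _ = _ := by rw [Real.mul_self_sqrt hpos.le]; ring

end system

/-! ### Local asymptotics at a regular point -/

/-- The Dirichlet kernel `∑_{k < n} (x conj t) ^ k` as a polynomial in `x`. -/
def dirichletPoly (n : ℕ) (t : ℂ) : ℂ[X] := ∑ k ∈ Finset.range n, C (conj t ^ k) * X ^ k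

lemma degree_dirichletPoly_lt (n : ℕ) (t : ℂ) : (dirichletPoly n t).degree < n := by
  rw [degree_lt_iff_coeff_zero]
  intro m hm
  rw [dirichletPoly, finsetSum_coeff]
  refine Finset.sum_eq_zero fun k hk => ?_
  have := Finset.mem_range.1 hk
  rw [coeff_C_mul_X_pow, if_neg (by omega)]

lemma coeff_dirichletPoly {n i : ℕ} (t : ℂ) (hi : i < n) :
    (dirichletPoly n t).coeff i = conj t ^ i := by
  rw [dirichletPoly, finsetSum_coeff]
  simp only [coeff_C_mul_X_pow, Finset.sum_ite_eq, Finset.mem_range, hi, if_true]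

lemma eval_dirichletPoly (n : ℕ) (t x : ℂ) :
    (dirichletPoly n t).eval x = ∑ k ∈ Finset.range n, (x * conj t) ^ k := by
  simp only [dirichletPoly, eval_finsetSum, eval_mul, eval_C, eval_pow, eval_X]
  exact Finset.sum_congr rfl fun k _ => by ring

lemma sub_mul_eval_dirichletPoly (n : ℕ) (t : Circle) (x : ℂ) :
    (x - t) * (dirichletPoly n t).eval x = t * ((x * conj (t : ℂ)) ^ n - 1) := by
  have ht : (t : ℂ) * conj (t : ℂ) = 1 := coe_mul_conj_coe _
  rw [eval_dirichletPoly, ← mul_geom_sum (x * conj (t : ℂ)) n]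
  linear_combination (- x * ∑ k ∈ Finset.range n, (x * conj (t : ℂ)) ^ k) * ht

lemma norm_eval_dirichletPoly_le (n : ℕ) (t x : Circle) :
    ‖(dirichletPoly n t).eval (x : ℂ)‖ ≤ n := by
  rw [eval_dirichletPoly]
  refine (norm_sum_le _ _).trans (le_of_eq ?_)
  simp [Circle.norm_coe]

lemma norm_eval_dirichletPoly_mul_le (n : ℕ) (t x : Circle) :
    ‖(x : ℂ) - t‖ * ‖(dirichletPoly n t).eval (x : ℂ)‖ ≤ 2 := by
  rw [← norm_mul, sub_mul_eval_dirichletPoly, norm_mul, Circle.norm_coe, one_mul]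
  refine (norm_sub_le _ _).trans ?_
  simp only [norm_pow, norm_mul, RCLike.norm_conj, Circle.norm_coe, norm_one]
  norm_num

lemma one_add_div_pow_le_exp {C : ℝ} (hC : 0 ≤ C) (n : ℕ) : (1 + C / n) ^ n ≤ Real.exp C := by
  rcases Nat.eq_zero_or_pos n with rfl | hn
  · simpa using hC
  · have hn' : (0 : ℝ) < n := by exact_mod_cast hn
    calc (1 + C / n) ^ n ≤ Real.exp (C / n) ^ n := by
          gcongr
          linarith [Real.add_one_le_exp (C / n)]
      _ = Real.exp C := by rw [← Real.exp_nat_mul]; congr 1; field_simp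

/-- Universality at a regular point: the cross product, hence the reproducing kernel, is asymptotic
to the one of arclength divided by `w(s)`. The reproducing property is tested against the Dirichlet
kernel; both kernels decay like `1 / d`, so that their product is concentrated at scale `1 / n` and
the measure may be replaced by `w(s) / (2π)` times arclength, for which the Dirichlet kernel is
itself reproducing. -/
lemma measDet_asymp {μ : ComplexMeasure Circle} (hμ : ClassTMinus μ) {w : Circle → ℂ}
    (hw : IsDensity μ w) {s : Circle} (hs : s ∈ regularSet μ w) {C η : ℝ} (hC : 1 ≤ C)
    (hη : 0 < η) :
    ∀ᶠ n : ℕ in atTop, ∀ l : ℂ, ∀ t : Circle, ‖l - s‖ ≤ C / n → ‖(t : ℂ) - s‖ ≤ C / n →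
      ‖w s * measDet μ n l t - (l ^ n - (t : ℂ) ^ n)‖ ≤ η := by
  have hsys := szegoSystem hμ
  set M := Real.exp C with hM
  have hM1 : 1 ≤ M := Real.one_le_exp (by linarith)
  have hC2 : 1 ≤ C ^ 2 := one_le_pow₀ hC
  have hMC : M ≤ M * C ^ 2 := le_mul_of_one_le_right (by linarith) hC2
  filter_upwards [integral_approx hw hs (L := 16 * M * C ^ 2) (η := η / (2 * C)) (by positivity)
    (by positivity), eventually_gt_atTop 0] with n hn hn0 l t hl ht
  have hn' : (0 : ℝ) < n := by exact_mod_cast hn0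
  set k := SzegoSystem.reprPoly (leftMonic μ) (rightMonic μ) (szegoCoeff μ) n l with hk
  set q := dirichletPoly n (t : ℂ) with hq
  have hr1 : 1 ≤ 1 + C / n := by
    have : 0 ≤ C / n := by positivity
    linarith
  have hlr : ‖l‖ ≤ 1 + C / n := by
    calc ‖l‖ = ‖(s : ℂ) + (l - s)‖ := by ring_nf
      _ ≤ ‖(s : ℂ)‖ + ‖l - s‖ := norm_add_le _ _
      _ ≤ _ := by rw [Circle.norm_coe]; linarith
  have hrn : (1 + C / n) ^ n ≤ M := one_add_div_pow_le_exp (by linarith) n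
  have hk1 : ∀ x : Circle, ‖k.eval (x : ℂ)‖ ≤ 2 * M * n := by
    intro x
    have h1 := hsys.norm_kern_le n hr1 hlr x.norm_coe
    rw [SzegoSystem.kern, RCLike.norm_conj] at h1
    exact h1.trans (by gcongr)
  have hk2 : ∀ x : Circle, ‖l - x‖ * ‖k.eval (x : ℂ)‖ ≤ 2 * M := by
    intro x
    have h1 := hsys.norm_sub_mul_norm_kern n l x.norm_coe
    rw [SzegoSystem.kern, RCLike.norm_conj] at h1
    rw [h1]
    exact (hsys.norm_crossDet_le n hr1 hlr x.norm_coe).trans (by gcongr)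
  have hq1 := norm_eval_dirichletPoly_le n t
  have hq2 := norm_eval_dirichletPoly_mul_le n t
  have hint1 : μ.integral (fun z : Circle => (Polynomial.C ((n : ℂ)⁻¹) * q).eval (z : ℂ) *
      conj (k.eval (z : ℂ))) (ContinuousLinearMap.mul ℝ ℂ) = (n : ℂ)⁻¹ * q.eval l := by
    rw [← pairing_eq, hsys.toeplitz.smul_left, hsys.reproducing l n q (degree_dirichletPoly_lt n t)]
  have hint2 : ∫ z : Circle, (Polynomial.C ((n : ℂ)⁻¹) * q).eval (z : ℂ) *
      conj (k.eval (z : ℂ)) ∂arcLength =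
        (n : ℂ)⁻¹ * (((2 * Real.pi : ℝ) : ℂ) * conj (k.eval (t : ℂ))) := by
    simp only [eval_mul, eval_C, mul_assoc]
    rw [integral_const_mul, integral_eval_mul_conj_eval (degree_dirichletPoly_lt n t)
      (hsys.degree_reprPoly_lt n l)]
    congr 2
    have hkt : k.eval (t : ℂ) = ∑ i ∈ Finset.range n, k.coeff i * (t : ℂ) ^ i := by
      rcases eq_or_ne k 0 with h0 | h0
      · simp [h0]
      · exact eval_eq_sum_range' ((natDegree_lt_iff_degree_lt h0).2 (hsys.degree_reprPoly_lt n l)) _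
    rw [hkt, map_sum]
    refine Finset.sum_congr rfl fun i hi => ?_
    rw [coeff_dirichletPoly _ (Finset.mem_range.1 hi), map_mul, map_pow, mul_comm]
  have hf : ∀ x : Circle, ‖(Polynomial.C ((n : ℂ)⁻¹) * q).eval (x : ℂ) * conj (k.eval (x : ℂ))‖ =
      (n : ℝ)⁻¹ * (‖q.eval (x : ℂ)‖ * ‖k.eval (x : ℂ)‖) := by
    intro x
    rw [eval_mul, eval_C, norm_mul, norm_mul, norm_inv, Complex.norm_natCast, RCLike.norm_conj,
      mul_assoc]
  have hmain := hn (fun z : Circle => (Polynomial.C ((n : ℂ)⁻¹) * q).eval (z : ℂ) *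
      conj (k.eval (z : ℂ))) (by fun_prop) ?_ ?_
  · rw [hint1, hint2] at hmain
    have hpi : ((2 * Real.pi : ℝ) : ℂ) ≠ 0 := by exact_mod_cast Real.two_pi_pos.ne'
    have h1 : (n : ℂ)⁻¹ * q.eval l - (n : ℂ)⁻¹ * (((2 * Real.pi : ℝ) : ℂ) * conj (k.eval (t : ℂ))) *
        (w s / ((2 * Real.pi : ℝ) : ℂ)) = (n : ℂ)⁻¹ * (q.eval l - w s * conj (k.eval (t : ℂ))) := by
      field_simp
    rw [h1, norm_mul, norm_inv, Complex.norm_natCast, inv_mul_le_iff₀ hn'] at hmain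
    have hcd := hsys.christoffel_darboux n l t.norm_coe
    rw [SzegoSystem.kern] at hcd
    have hdir := sub_mul_eval_dirichletPoly n t l
    have htt : (t : ℂ) * conj (t : ℂ) = 1 := coe_mul_conj_coe _
    have htn : (t : ℂ) ^ n * (l * conj (t : ℂ)) ^ n = l ^ n := by
      rw [← mul_pow]
      congr 1
      linear_combination l * htt
    have h2 : (w s * measDet μ n l t - (l ^ n - (t : ℂ) ^ n)) * t =
        -((t : ℂ) ^ n * ((l - t) * (q.eval l - w s * conj (k.eval (t : ℂ))))) := by
      linear_combination w s * hcd + (t : ℂ) ^ n * hdir + (t : ℂ) * htn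
    have h3 := congrArg norm h2
    rw [norm_mul, norm_neg, norm_mul, norm_mul, norm_pow, Circle.norm_coe, one_pow, mul_one,
      one_mul] at h3
    have hlt : ‖l - t‖ ≤ 2 * C / n := by
      calc ‖l - t‖ = ‖(l - s) - (t - s)‖ := by ring_nf
        _ ≤ ‖l - s‖ + ‖(t : ℂ) - s‖ := norm_sub_le _ _
        _ ≤ C / n + C / n := add_le_add hl ht
        _ = _ := by ring
    rw [h3]
    calc _ ≤ 2 * C / n * (n * (η / (2 * C))) := by gcongr
      _ = η := by field_simp
  · intro x
    rw [hf, inv_mul_le_iff₀ hn']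
    calc _ ≤ n * (2 * M * n) := mul_le_mul (hq1 x) (hk1 x) (norm_nonneg _) hn'.le
      _ ≤ n * (16 * M * C ^ 2 * n) := by
        gcongr n * (?_ * n)
        nlinarith
  · intro x
    rw [hf]
    have hd : dist x s = ‖(x : ℂ) - s‖ := by
      change dist (x : ℂ) (s : ℂ) = _
      rw [dist_eq_norm]
    rw [hd]
    set d := ‖(x : ℂ) - s‖
    have heq : (n : ℝ)⁻¹ * (‖q.eval (x : ℂ)‖ * ‖k.eval (x : ℂ)‖) * (n * d ^ 2) =
        ‖q.eval (x : ℂ)‖ * ‖k.eval (x : ℂ)‖ * d ^ 2 := by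
      field_simp
    rw [heq]
    -- Far from `s`, both kernels are `O (1 / d)`; close to `s`, the trivial bounds suffice.
    rcases le_or_gt d (2 * (C / n)) with hdn | hdn
    · calc _ ≤ n * (2 * M * n) * (2 * (C / n)) ^ 2 := by
            gcongr
            exacts [hq1 x, hk1 x]
        _ = 8 * (M * C ^ 2) := by field_simp; ring
        _ ≤ _ := by nlinarith
    · have hxt : d ≤ 2 * ‖(x : ℂ) - t‖ := by
        have : d ≤ ‖(x : ℂ) - t‖ + ‖(t : ℂ) - s‖ := norm_sub_le_norm_sub_add_norm_sub _ _ _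
        linarith
      have hxl : d ≤ 2 * ‖l - (x : ℂ)‖ := by
        have : d ≤ ‖(x : ℂ) - l‖ + ‖l - s‖ := norm_sub_le_norm_sub_add_norm_sub _ _ _
        rw [norm_sub_rev] at this
        linarith
      calc ‖q.eval (x : ℂ)‖ * ‖k.eval (x : ℂ)‖ * d ^ 2
          = ‖q.eval (x : ℂ)‖ * ‖k.eval (x : ℂ)‖ * (d * d) := by ring
        _ ≤ ‖q.eval (x : ℂ)‖ * ‖k.eval (x : ℂ)‖ * ((2 * ‖(x : ℂ) - t‖) * (2 * ‖l - (x : ℂ)‖)) := by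
            gcongr
        _ = 4 * ((‖(x : ℂ) - t‖ * ‖q.eval (x : ℂ)‖) * (‖l - (x : ℂ)‖ * ‖k.eval (x : ℂ)‖)) := by ring
        _ ≤ 4 * (2 * (2 * M)) := by
            gcongr 4 * ?_
            exact mul_le_mul (hq2 x) (hk2 x) (by positivity) zero_le_two
        _ ≤ _ := by nlinarith

lemma norm_gam (n : ℕ) : ‖gam n‖ = 1 := by
  rw [gam, show Complex.I * (Real.pi : ℂ) / n = ((Real.pi / n : ℝ) : ℂ) * Complex.I by
    push_cast; ring]
  exact Complex.norm_exp_ofReal_mul_I _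

lemma gam_pow {n : ℕ} (hn : 0 < n) : gam n ^ n = -1 := by
  have hn' : (n : ℂ) ≠ 0 := by exact_mod_cast hn.ne'
  rw [gam, ← Complex.exp_nat_mul, mul_div_cancel₀ _ hn', mul_comm, Complex.exp_pi_mul_I]

lemma norm_gam_sub_one_le (n : ℕ) : ‖gam n - 1‖ ≤ Real.pi / n := by
  rw [gam, show Complex.I * (Real.pi : ℂ) / n = Complex.I * ((Real.pi / n : ℝ) : ℂ) by
    push_cast; ring]
  refine (Real.norm_exp_I_mul_ofReal_sub_one_le (x := Real.pi / n)).trans (le_of_eq ?_)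
  exact Real.norm_of_nonneg (by positivity)

lemma norm_phi_circle_le {μ : ComplexMeasure Circle} (hμ : ClassTMinus μ) (n : ℕ) {x : ℂ}
    (hx : ‖x‖ = 1) : ‖(phi μ n).eval x‖ ≤ 2 := by
  refine (norm_phi_le hμ n le_rfl hx.le).trans ?_
  rw [one_pow, mul_one, Real.sqrt_le_left zero_le_two]
  norm_num

lemma norm_coe_mul_gam (n : ℕ) (s : Circle) : ‖(s : ℂ) * gam n‖ = 1 := by
  rw [norm_mul, Circle.norm_coe, norm_gam, mul_one]

lemma norm_paramA_le {μ : ComplexMeasure Circle} (hμ : ClassTMinus μ) (n : ℕ) (s : Circle) :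
    ‖paramA μ n s‖ ≤ 2 := by
  rw [paramA, norm_div, norm_mul, norm_pow, Circle.norm_coe, one_pow, mul_one, Complex.norm_two]
  have := norm_sub_le ((phi μ n).eval (s : ℂ)) ((phi μ n).eval ((s : ℂ) * gam n))
  linarith [norm_phi_circle_le hμ n s.norm_coe, norm_phi_circle_le hμ n (norm_coe_mul_gam n s)]

lemma norm_paramB_le {μ : ComplexMeasure Circle} (hμ : ClassTMinus μ) (n : ℕ) (s : Circle) :
    ‖paramB μ n s‖ ≤ 2 := by
  rw [paramB, norm_div, Complex.norm_two]
  have := norm_add_le ((phi μ n).eval (s : ℂ)) ((phi μ n).eval ((s : ℂ) * gam n))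
  linarith [norm_phi_circle_le hμ n s.norm_coe, norm_phi_circle_le hμ n (norm_coe_mul_gam n s)]

/-- At scale `1 / n` around a regular point, `φ_n` is asymptotic to the binomial `A z ^ n + B` which
interpolates it at `s` and `s γ_n`, and the coefficients are not small unless `w(s)` is large. -/
lemma phi_asymp {μ : ComplexMeasure Circle} (hμ : ClassTMinus μ) {w : Circle → ℂ}
    (hw : IsDensity μ w) {s : Circle} (hs : s ∈ regularSet μ w) {C η : ℝ} (hC : 4 ≤ C)
    (hη : 0 < η) :
    ∀ᶠ n : ℕ in atTop,
      (∀ l : ℂ, ‖l - s‖ ≤ C / n →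
        ‖(phi μ n).eval l - (paramA μ n s * l ^ n + paramB μ n s)‖ ≤ η) ∧
      1 ≤ 4 * ‖w s‖ * (‖paramA μ n s‖ + ‖paramB μ n s‖) := by
  set M := 2 * Real.exp C with hM
  have hM0 : 0 < M := by positivity
  have hM2 : 2 ≤ M := by
    have := Real.one_le_exp (by linarith : 0 ≤ C)
    linarith
  set δ := min 1 (η / (2 * M)) with hδ
  have hδ0 : 0 < δ := by positivity
  filter_upwards [measDet_asymp hμ hw hs (C := C) (η := δ) (by linarith) hδ0,
    eventually_gt_atTop 0] with n hn hn0
  have hn' : (0 : ℝ) < n := by exact_mod_cast hn0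
  obtain ⟨t, ht⟩ : ∃ t : Circle, (t : ℂ) = s * gam n :=
    ⟨⟨s * gam n, mem_sphere_zero_iff_norm.2 (norm_coe_mul_gam n s)⟩, rfl⟩
  have htn : (t : ℂ) ^ n = -(s : ℂ) ^ n := by rw [ht, mul_pow, gam_pow hn0]; ring
  have hts : ‖(t : ℂ) - s‖ ≤ C / n := by
    rw [ht, show (s : ℂ) * gam n - s = s * (gam n - 1) by ring, norm_mul, Circle.norm_coe, one_mul]
    refine (norm_gam_sub_one_le n).trans ?_
    gcongr
    linarith [Real.pi_le_four]
  have hss : ‖(s : ℂ) - s‖ ≤ C / n := by rw [sub_self, norm_zero]; positivity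
  have hA : paramA μ n s = ((phi μ n).eval (s : ℂ) - (phi μ n).eval (t : ℂ)) / (2 * (s : ℂ) ^ n) := by
    rw [paramA, ht]
  have hB : paramB μ n s = ((phi μ n).eval (s : ℂ) + (phi μ n).eval (t : ℂ)) / 2 := by
    rw [paramB, ht]
  have hsn0 : (s : ℂ) ^ n ≠ 0 := pow_ne_zero _ (Circle.coe_ne_zero s)
  have hsn : ‖(s : ℂ) ^ n‖ = 1 := by rw [norm_pow, Circle.norm_coe, one_pow]
  have h1 := hn s t hss hts
  rw [htn, sub_neg_eq_add] at h1
  refine ⟨fun l hl => ?_, ?_⟩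
  · have h2 := hn l t hl hts
    have h3 := hn l s hl hss
    rw [htn, sub_neg_eq_add] at h2
    have hpl := phi_mul_measDet hμ n l s t
    set e₁ := w s * measDet μ n s t - ((s : ℂ) ^ n + (s : ℂ) ^ n) with he₁
    set e₂ := w s * measDet μ n l t - (l ^ n + (s : ℂ) ^ n) with he₂
    set e₃ := w s * measDet μ n l s - (l ^ n - (s : ℂ) ^ n) with he₃
    have hid : 2 * (s : ℂ) ^ n * ((phi μ n).eval l - (paramA μ n s * l ^ n + paramB μ n s)) =
        (phi μ n).eval (s : ℂ) * e₂ - (phi μ n).eval (t : ℂ) * e₃ - (phi μ n).eval l * e₁ := by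
      rw [hA, hB, he₁, he₂, he₃]
      field_simp
      linear_combination w s * hpl
    have hphil : ‖(phi μ n).eval l‖ ≤ M := by
      have hlr : ‖l‖ ≤ 1 + C / n := by
        calc ‖l‖ = ‖(s : ℂ) + (l - s)‖ := by ring_nf
          _ ≤ ‖(s : ℂ)‖ + ‖l - s‖ := norm_add_le _ _
          _ ≤ _ := by rw [Circle.norm_coe]; linarith
      have h0 : 0 ≤ C / n := by positivity
      refine (norm_phi_le hμ n (by linarith) hlr).trans ?_
      refine mul_le_mul ?_ (one_add_div_pow_le_exp (by linarith) n) (by positivity) zero_le_two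
      rw [Real.sqrt_le_left zero_le_two]
      norm_num
    have hnorm := congrArg norm hid
    rw [norm_mul, norm_mul, hsn, Complex.norm_two, mul_one] at hnorm
    have hle : 2 * ‖(phi μ n).eval l - (paramA μ n s * l ^ n + paramB μ n s)‖ ≤
        M * δ + M * δ + M * δ := by
      rw [hnorm]
      refine (norm_sub_le _ _).trans (add_le_add ((norm_sub_le _ _).trans (add_le_add ?_ ?_)) ?_)
      · rw [norm_mul]
        exact mul_le_mul ((norm_phi_circle_le hμ n s.norm_coe).trans hM2) h2 (norm_nonneg _) hM0.le
      · rw [norm_mul]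
        exact mul_le_mul ((norm_phi_circle_le hμ n t.norm_coe).trans hM2) h3 (norm_nonneg _) hM0.le
      · rw [norm_mul]
        exact mul_le_mul hphil h1 (norm_nonneg _) hM0.le
    have hMδ : M * δ ≤ η / 2 := by
      calc M * δ ≤ M * (η / (2 * M)) := by gcongr; exact min_le_right _ _
        _ = η / 2 := by field_simp
    linarith
  · have h2 : 1 ≤ ‖w s‖ * ‖measDet μ n s t‖ := by
      rw [← norm_mul]
      have h3 : ‖(s : ℂ) ^ n + (s : ℂ) ^ n‖ = 2 := by
        rw [← two_mul, norm_mul, hsn, Complex.norm_two, mul_one]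
      have h4 := norm_sub_norm_le ((s : ℂ) ^ n + (s : ℂ) ^ n) (w s * measDet μ n s t)
      rw [norm_sub_rev] at h4
      have h5 : δ ≤ 1 := min_le_left _ _
      linarith
    have h3 := norm_measDet_le hμ n s.norm_coe t.norm_coe
    have h4 : (phi μ n).eval (s : ℂ) = paramA μ n s * (s : ℂ) ^ n + paramB μ n s := by
      rw [hA, hB]; field_simp; ring
    have h5 : (phi μ n).eval (t : ℂ) = -(paramA μ n s * (s : ℂ) ^ n) + paramB μ n s := by
      rw [hA, hB]; field_simp; ring
    have h6 : ‖(phi μ n).eval (s : ℂ)‖ ≤ ‖paramA μ n s‖ + ‖paramB μ n s‖ := by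
      rw [h4]
      refine (norm_add_le _ _).trans ?_
      rw [norm_mul, hsn, mul_one]
    have h7 : ‖(phi μ n).eval (t : ℂ)‖ ≤ ‖paramA μ n s‖ + ‖paramB μ n s‖ := by
      rw [h5]
      refine (norm_add_le _ _).trans ?_
      rw [norm_neg, norm_mul, hsn, mul_one]
    calc (1 : ℝ) ≤ ‖w s‖ * ‖measDet μ n s t‖ := h2
      _ ≤ ‖w s‖ * (2 * ((‖paramA μ n s‖ + ‖paramB μ n s‖) +
          (‖paramA μ n s‖ + ‖paramB μ n s‖))) := by
        gcongr
        exact h3.trans (by gcongr)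
      _ = _ := by ring

/-! ### Zeros of functions close to a binomial -/

lemma norm_exp_sub_one_ge {ζ : ℂ} (hζ : ‖ζ‖ = 1 / 2) : 1 / 4 ≤ ‖1 - Complex.exp ζ‖ := by
  have h1 := Complex.norm_exp_sub_one_sub_id_le (x := ζ) (by rw [hζ]; norm_num)
  rw [hζ] at h1
  rw [norm_sub_rev, show Complex.exp ζ - 1 = ζ - (ζ - (Complex.exp ζ - 1)) by ring]
  have h2 := norm_sub_norm_le ζ (ζ - (Complex.exp ζ - 1))
  rw [norm_sub_rev ζ (Complex.exp ζ - 1), hζ] at h2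
  linarith

/-- A function close to `A z ^ n + B` has a zero near `s`, at distance `O (1 / n)`, when both
coefficients are bounded below: the substitution `z = s exp ((v + ζ) / n)`, with
`exp v = - B / (A s ^ n)`, turns the binomial into `B (1 - exp ζ)`. -/
lemma exists_zero_of_close {f : ℂ → ℂ} (hf : Differentiable ℂ f) {A B : ℂ} {n : ℕ} (s : Circle)
    {ε : ℝ} (hε₀ : 0 < ε) (hε₁ : ε ≤ 1) (hA : ‖A‖ ≤ 2) (hB : ‖B‖ ≤ 2) (hAB : ε ≤ ‖A * B‖)
    (hn : 10 * ε⁻¹ ≤ n)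
    (hclose : ∀ l : ℂ, ‖l - s‖ ≤ 20 * ε⁻¹ / n → ‖f l - (A * l ^ n + B)‖ ≤ ε / 64) :
    ∃ z : ℂ, f z = 0 ∧ ‖z - s‖ ≤ 20 * ε⁻¹ / n := by
  have hεi : 1 ≤ ε⁻¹ := (one_le_inv₀ hε₀).2 hε₁
  have hn' : (0 : ℝ) < n := by linarith
  have hnC : (n : ℂ) ≠ 0 := by
    intro h
    have : (n : ℝ) = 0 := by exact_mod_cast h
    linarith
  rw [norm_mul] at hAB
  have hA0 : ε / 2 ≤ ‖A‖ := by nlinarith [norm_nonneg A, norm_nonneg B]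
  have hB0 : ε / 2 ≤ ‖B‖ := by nlinarith [norm_nonneg A, norm_nonneg B]
  have hAne : A ≠ 0 := norm_pos_iff.1 (by linarith)
  have hBne : B ≠ 0 := norm_pos_iff.1 (by linarith)
  have hsn0 : (s : ℂ) ^ n ≠ 0 := pow_ne_zero _ (Circle.coe_ne_zero s)
  set u : ℂ := -B / (A * (s : ℂ) ^ n) with hu
  have hune : u ≠ 0 := div_ne_zero (neg_ne_zero.2 hBne) (mul_ne_zero hAne hsn0)
  have hunorm : ‖u‖ = ‖B‖ / ‖A‖ := by
    rw [hu, norm_div, norm_neg, norm_mul, norm_pow, Circle.norm_coe, one_pow, mul_one]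
  set v := Complex.log u with hv
  have hvexp : Complex.exp v = u := Complex.exp_log hune
  have hAp : 0 < ‖A‖ := by linarith
  have hBp : 0 < ‖B‖ := by linarith
  have hvnorm : ‖v‖ ≤ 4 * ε⁻¹ + 4 := by
    refine (Complex.norm_le_abs_re_add_abs_im v).trans (add_le_add ?_ ?_)
    · rw [hv, Complex.log_re, hunorm, abs_le]
      have hup : ∀ a b : ℝ, 0 < a → ε / 2 ≤ b → a ≤ 2 → Real.log (a / b) ≤ 4 * ε⁻¹ := by
        intro a b ha hb ha2
        have hb0 : 0 < b := by linarith
        refine (Real.log_le_self (by positivity)).trans ?_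
        rw [div_le_iff₀ hb0]
        calc a ≤ 2 := ha2
          _ = 4 * ε⁻¹ * (ε / 2) := by field_simp; norm_num
          _ ≤ _ := by gcongr
      constructor
      · have := hup ‖A‖ ‖B‖ hAp hB0 hA
        rw [← inv_div, Real.log_inv] at this
        linarith
      · exact hup ‖B‖ ‖A‖ hBp hA0 hB
    · rw [hv, Complex.log_im]
      exact (Complex.abs_arg_le_pi u).trans Real.pi_le_four
  set g : ℂ → ℂ := fun ζ => (s : ℂ) * Complex.exp ((v + ζ) / n) with hg
  have hgd : Differentiable ℂ g := by fun_prop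
  have hgs : ∀ ζ : ℂ, ‖ζ‖ ≤ 1 / 2 → ‖g ζ - s‖ ≤ 20 * ε⁻¹ / n := by
    intro ζ hζ
    have h1 : ‖(v + ζ) / n‖ ≤ 10 * ε⁻¹ / n := by
      rw [norm_div, Complex.norm_natCast]
      gcongr
      linarith [norm_add_le v ζ]
    have h2 : ‖(v + ζ) / n‖ ≤ 1 := h1.trans ((div_le_one hn').2 hn)
    rw [show g ζ - s = s * (Complex.exp ((v + ζ) / n) - 1) by simp only [hg]; ring, norm_mul,
      Circle.norm_coe, one_mul]
    calc _ ≤ 2 * ‖(v + ζ) / n‖ := Complex.norm_exp_sub_one_le h2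
      _ ≤ 2 * (10 * ε⁻¹ / n) := by gcongr
      _ = _ := by ring
  have hgn : ∀ ζ : ℂ, A * g ζ ^ n + B = B * (1 - Complex.exp ζ) := by
    intro ζ
    simp only [hg]
    rw [mul_pow, ← Complex.exp_nat_mul, mul_div_cancel₀ _ hnC, Complex.exp_add, hvexp, hu]
    field_simp
    ring
  set F : ℂ → ℂ := fun ζ => f (g ζ) with hF
  have hFd : Differentiable ℂ F := hf.comp hgd
  have hFc : ∀ ζ : ℂ, ‖ζ‖ ≤ 1 / 2 → ‖F ζ - B * (1 - Complex.exp ζ)‖ ≤ ε / 64 := by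
    intro ζ hζ
    rw [← hgn]
    exact hclose _ (hgs ζ hζ)
  have hF0 : ‖F 0‖ ≤ ε / 64 := by simpa using hFc 0 (by norm_num)
  have hsph : ∀ ζ ∈ Metric.sphere (0 : ℂ) (1 / 2), ε * (3 / 32) ≤ ‖F ζ - F 0‖ := by
    intro ζ hζ
    rw [mem_sphere_zero_iff_norm] at hζ
    have h1 := hFc ζ hζ.le
    have h2 : ε / 8 ≤ ‖B * (1 - Complex.exp ζ)‖ := by
      rw [norm_mul]
      calc ε / 8 = ε / 2 * (1 / 4) := by ring
        _ ≤ _ := mul_le_mul hB0 (norm_exp_sub_one_ge hζ) (by norm_num) (norm_nonneg _)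
    have h3 := norm_sub_norm_le (B * (1 - Complex.exp ζ)) (F ζ)
    rw [norm_sub_rev] at h3
    have h4 := norm_sub_norm_le (F ζ) (F 0)
    linarith
  have hfreq : ∃ᶠ ζ in 𝓝 (0 : ℂ), F ζ ≠ F 0 := by
    intro hev
    have hev' : F =ᶠ[𝓝 0] fun _ => F 0 := by
      filter_upwards [hev] with ζ hζ
      simpa using hζ
    have heq := AnalyticOnNhd.eq_of_eventuallyEq (f := F) (g := fun _ => F 0)
      (fun x _ => hFd.analyticAt x) (fun x _ => analyticAt_const) hev'
    have h1 := hsph (1 / 2) (by rw [mem_sphere_zero_iff_norm]; norm_num)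
    rw [heq] at h1
    simp only [sub_self, norm_zero] at h1
    linarith
  have hball := DiffContOnCl.ball_subset_image_closedBall (f := F) (z₀ := 0) (r := 1 / 2)
    hFd.diffContOnCl (by norm_num) hsph hfreq
  obtain ⟨ζ, hζ, hζ0⟩ := hball (show (0 : ℂ) ∈ Metric.ball (F 0) (ε * (3 / 32) / 2) by
    rw [Metric.mem_ball, dist_zero_left]
    linarith)
  exact ⟨g ζ, hζ0, hgs ζ (mem_closedBall_zero_iff.1 hζ)⟩

lemma exp_neg_two_mul_le {x : ℝ} (h₀ : 0 ≤ x) (h₁ : x ≤ 1 / 2) : Real.exp (-(2 * x)) ≤ 1 - x := by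
  rw [Real.exp_neg, inv_le_comm₀ (Real.exp_pos _) (by linarith)]
  refine le_trans ?_ (Real.add_one_le_exp (2 * x))
  rw [inv_le_iff_one_le_mul₀ (by linarith)]
  nlinarith

/-- The coefficients of a binomial close to a function with a zero near the circle have comparable
sizes, so that both are bounded below as soon as their sum is. -/
lemma coeff_mul_ge_of_zero {A B z : ℂ} {n : ℕ} (s : Circle) {ε : ℝ} (hε₀ : 0 < ε)
    (hε₁ : ε < 1 / 10 ^ 5) (hn : 2 * ε⁻¹ ≤ n) (hz : ‖z - s‖ ≤ ε⁻¹ / n)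
    (hclose : ‖A * z ^ n + B‖ ≤ Real.exp (-10 * ε⁻¹)) {W : ℝ}
    (hW : W < Real.exp ε⁻¹) (hAB : 1 ≤ 4 * W * (‖A‖ + ‖B‖)) :
    Real.exp (-10 * ε⁻¹) ≤ ‖A * B‖ := by
  have hε5 : 10 ^ 5 ≤ ε⁻¹ := by
    rw [le_inv_comm₀ (by norm_num) hε₀, ← one_div]
    exact hε₁.le
  have hn' : (0 : ℝ) < n := by linarith
  set q := Real.exp (-ε⁻¹) with hq
  have hq0 : 0 < q := Real.exp_pos _
  have hqe : Real.exp ε⁻¹ = q⁻¹ := by rw [hq, Real.exp_neg, inv_inv]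
  have hq1 : q ≤ 1 / 10 ^ 5 := by
    rw [hq, Real.exp_neg, inv_le_comm₀ (Real.exp_pos _) (by norm_num)]
    have := Real.add_one_le_exp ε⁻¹
    norm_num
    linarith
  have hq10 : Real.exp (-10 * ε⁻¹) = q ^ 10 := by
    rw [hq, ← Real.exp_nat_mul]
    congr 1
    push_cast
    ring
  rw [hq10] at hclose ⊢
  rw [hqe] at hW
  have hsum : q / 4 ≤ ‖A‖ + ‖B‖ := by
    have h1 : 4 * W * (‖A‖ + ‖B‖) ≤ 4 * q⁻¹ * (‖A‖ + ‖B‖) := by gcongr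
    have h2 : 1 ≤ 4 * q⁻¹ * (‖A‖ + ‖B‖) := hAB.trans h1
    calc q / 4 = q / 4 * 1 := by ring
      _ ≤ q / 4 * (4 * q⁻¹ * (‖A‖ + ‖B‖)) := by gcongr
      _ = _ := by field_simp
  have hx : 0 ≤ ε⁻¹ / n := by positivity
  have hup : ‖z‖ ^ n ≤ q⁻¹ := by
    rw [← hqe]
    refine le_trans ?_ (one_add_div_pow_le_exp (C := ε⁻¹) (by positivity) n)
    gcongr
    calc ‖z‖ = ‖(s : ℂ) + (z - s)‖ := by ring_nf
      _ ≤ ‖(s : ℂ)‖ + ‖z - s‖ := norm_add_le _ _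
      _ ≤ _ := by rw [Circle.norm_coe]; linarith
  have hlow : q ^ 2 ≤ ‖z‖ ^ n := by
    have h1 : 1 - ε⁻¹ / n ≤ ‖z‖ := by
      have := norm_sub_norm_le (s : ℂ) z
      rw [Circle.norm_coe, norm_sub_rev] at this
      linarith
    have h2 : ε⁻¹ / n ≤ 1 / 2 := by
      rw [div_le_iff₀ hn']
      linarith
    calc q ^ 2 = Real.exp (-(2 * (ε⁻¹ / n))) ^ n := by
          rw [hq, ← Real.exp_nat_mul, ← Real.exp_nat_mul]
          congr 1
          push_cast
          field_simp
      _ ≤ ‖z‖ ^ n := by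
          gcongr
          exact (exp_neg_two_mul_le hx h2).trans h1
  set R := ‖z‖ ^ n with hR
  have hAR : ‖A * z ^ n‖ = ‖A‖ * R := by rw [norm_mul, norm_pow]
  have hc1 : ‖A‖ * R ≤ ‖B‖ + q ^ 10 := by
    have := norm_sub_le (A * z ^ n + B) B
    rw [add_sub_cancel_right, hAR] at this
    linarith
  have hc2 : ‖B‖ ≤ ‖A‖ * R + q ^ 10 := by
    have := norm_sub_le (A * z ^ n + B) (A * z ^ n)
    rw [add_sub_cancel_left, hAR] at this
    linarith
  have hqk : ∀ k m : ℕ, m ≤ k → q ^ k ≤ q ^ m := fun k m h =>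
    pow_le_pow_of_le_one hq0.le (hq1.trans (by norm_num)) h
  have hsmall : ∀ k : ℕ, q ^ (k + 1) ≤ q ^ k / 128 := by
    intro k
    rw [pow_succ, div_eq_mul_one_div]
    gcongr
    exact hq1.trans (by norm_num)
  rw [norm_mul]
  have hA0 := norm_nonneg A
  have hB0 := norm_nonneg B
  rcases le_or_gt (q / 8) ‖A‖ with hA | hA
  · have h1 : q / 8 * q ^ 2 ≤ ‖A‖ * R := mul_le_mul hA hlow (by positivity) hA0
    have h2 : q ^ 10 ≤ q ^ 3 / 128 := (hqk 10 4 (by norm_num)).trans (hsmall 3)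
    have h3 : q ^ 3 / 16 ≤ ‖B‖ := by
      have : q / 8 * q ^ 2 = q ^ 3 / 8 := by ring
      have : 0 < q ^ 3 := by positivity
      linarith
    calc q ^ 10 ≤ q ^ 4 / 128 := (hqk 10 5 (by norm_num)).trans (hsmall 4)
      _ = q / 8 * (q ^ 3 / 16) := by ring
      _ ≤ _ := mul_le_mul hA h3 (by positivity) hA0
  · have hB : q / 8 ≤ ‖B‖ := by linarith
    have h2 : q ^ 10 ≤ q ^ 1 / 128 := (hqk 10 2 (by norm_num)).trans (hsmall 1)
    rw [pow_one] at h2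
    have h3 : q / 16 ≤ ‖A‖ * q⁻¹ := by
      have : ‖A‖ * R ≤ ‖A‖ * q⁻¹ := by gcongr
      linarith
    have h4 : q ^ 2 / 16 ≤ ‖A‖ := by
      rw [← div_eq_mul_inv, le_div_iff₀ hq0] at h3
      calc q ^ 2 / 16 = q / 16 * q := by ring
        _ ≤ _ := h3
    calc q ^ 10 ≤ q ^ 3 / 128 := (hqk 10 4 (by norm_num)).trans (hsmall 3)
      _ = q ^ 2 / 16 * (q / 8) := by ring
      _ ≤ _ := mul_le_mul h4 hB (by positivity) hA0

end OneSidedOP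

end

theorem theorem3 (μ : MeasureTheory.ComplexMeasure Circle) (hμ : OneSidedOP.ClassTMinus μ)
    (w : Circle → ℂ) (hw : OneSidedOP.IsDensity μ w)
    (s : Circle) (hs : s ∈ OneSidedOP.regularSet μ w)
    (ε : ℝ) (hε₀ : 0 < ε) (hε₁ : ε < 1 / 10 ^ 5) :
    ∃ n₀ : ℕ, 40 < n₀ ∧ ∀ n : ℕ, n₀ < n →
      (ε ≤ ‖OneSidedOP.paramA μ n s * OneSidedOP.paramB μ n s‖ →
        ∃ z : ℂ, (OneSidedOP.phi μ n).eval z = 0 ∧ ‖z - (s : ℂ)‖ ≤ 10 ^ 4 * ε⁻¹ * (n : ℝ)⁻¹) ∧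
      (‖w s‖ < Real.exp ε⁻¹ →
        (∃ z : ℂ, (OneSidedOP.phi μ n).eval z = 0 ∧ ‖z - (s : ℂ)‖ ≤ ε⁻¹ * (n : ℝ)⁻¹) →
        Real.exp (-10 * ε⁻¹) ≤ ‖OneSidedOP.paramA μ n s * OneSidedOP.paramB μ n s‖) := by
  have hε : ε ≤ 1 := hε₁.le.trans (by norm_num)
  have hεi : 1 ≤ ε⁻¹ := (one_le_inv₀ hε₀).2 hε
  have h := (OneSidedOP.phi_asymp hμ hw hs (C := 20 * ε⁻¹)
    (η := min (ε / 64) (Real.exp (-10 * ε⁻¹))) (by linarith) (by positivity)).and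
    (tendsto_natCast_atTop_atTop.eventually_ge_atTop (10 * ε⁻¹))
  obtain ⟨N, hN⟩ := eventually_atTop.1 h
  refine ⟨max 41 N, lt_max_of_lt_left (by norm_num), fun n hn => ?_⟩
  obtain ⟨⟨hclose, hsum⟩, hn10⟩ := hN n ((le_max_right _ _).trans hn.le)
  have hn' : (0 : ℝ) < n := by linarith
  refine ⟨fun hAB => ?_, fun hw1 ⟨z, hz0, hz⟩ => ?_⟩
  · obtain ⟨z, hz0, hz⟩ := OneSidedOP.exists_zero_of_close (f := fun z => (OneSidedOP.phi μ n).eval z)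
      (OneSidedOP.phi μ n).differentiable s hε₀ hε (OneSidedOP.norm_paramA_le hμ n s)
      (OneSidedOP.norm_paramB_le hμ n s) hAB hn10
      (fun l hl => (hclose l hl).trans (min_le_left _ _))
    refine ⟨z, hz0, hz.trans ?_⟩
    rw [div_eq_mul_inv]
    gcongr
    norm_num
  · rw [← div_eq_mul_inv] at hz
    refine OneSidedOP.coeff_mul_ge_of_zero s hε₀ hε₁ (by linarith) hz ?_ hw1 hsum
    have h1 := hclose z (hz.trans (by gcongr; linarith))
    rw [hz0, zero_sub, norm_neg] at h1
    exact h1.trans (min_le_right _ _)
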